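/- Let $\mathbb S=\mathbb R/\mathbb Z$, let $C^\infty(\mathbb S)$ be the Fréchet space of smooth real functions on $\mathbb S$ (topology of uniform convergence of every derivative), and let $\mathcal D$ be the group of smooth orientation-preserving diffeomorphisms of $\mathbb S$. It is a Fréchet manifold modelled on $C^\infty(\mathbb S)$, the inverses of the charts being $u\mapsto\varphi_0+u$ for $\varphi_0\in\mathcal D$ and $u$ of absolute value less than $1/2$ with $\varphi_0+u\in\mathcal D$. All changes of charts are translations, so every tangent space $T_\eta\mathcal D$ is identified with $C^\infty(\mathbb S)$, and a vector field on $\mathcal D$ is a map $X:\mathcal D\to C^\infty(\mathbb S)$; right translation is $R_{\eta*}V=V\circ\eta$. Smoothness of maps on $\mathcal D$ is understood in the usual sense of Fréchet calculus: in charts, the iterated directional derivatives of all orders exist and are jointly continuous. Let $\mathcal F(\mathcal D)$ be the ring of smooth real functions on $\mathcal D$ and $\mathcal X(\mathcal D)$ the $\mathcal F(\mathcal D)$-module of smooth vector fields on $\mathcal D$. For a function or vector field $f$ on $\mathcal D$ put $(D_Xf)(\varphi)=\lim_{h\to0}\frac1h\bigl(f(\varphi+hX(\varphi))-f(\varphi)\bigr)$,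 and let $[X,Y]=D_XY-D_YX$ for vector fields $X,Y$. For $k\ge0$ let $$\langle u,v\rangle_k=\sum_{i=0}^k\int_{\mathbb S}(\partial_x^iu)(\partial_x^iv)\,dx,\quad u,v\in C^\infty(\mathbb S),\qquad \langle V,W\rangle_k=\langle V\circ\eta^{-1},W\circ\eta^{-1}\rangle_k,\quad V,W\in T_\eta\mathcal D,$$ so that the second formula defines the right-invariant (weak) $H^k$ metric on $\mathcal D$. Let $A_k=1-\frac{d^2}{dx^2}+\dots+(-1)^k\frac{d^{2k}}{dx^{2k}}$ on $C^\infty(\mathbb S)$ and $$B_k(u,v)=-A_k^{-1}\bigl(2v_xA_k(u)+vA_k(u_x)\bigr),\qquad u,v\in C^\infty(\mathbb S).$$ For right-invariant vector fields $X,Y$ on $\mathcal D$ put $B_k(X,Y)_\eta=B_k(X_{Id},Y_{Id})\circ\eta$. For a vector field $X$ and $\eta\in\mathcal D$ let $X^R_\eta$ be the right-invariant vector field whose value at $\eta$ is $X_\eta$, that is, $\varphi\mapsto X_\eta\circ\eta^{-1}\circ\varphi$. **Theorem.** Let $k\ge0$. The operator $A_k:C^\infty(\mathbb S)\to C^\infty(\mathbb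 S)$ is bijective (so that $B_k$ is well defined), and there is a unique Riemannian connection $\nabla^k$ on $\mathcal D$ for the right-invariant $H^k$ metric, that is, a unique map $\nabla^k:\mathcal X(\mathcal D)\times\mathcal X(\mathcal D)\to\mathcal X(\mathcal D)$ which is $\mathcal F(\mathcal D)$-linear in the first argument and additive in the second, and satisfies, for all $f\in\mathcal F(\mathcal D)$ and $X,Y,Z\in\mathcal X(\mathcal D)$, $$\nabla^k_X(fY)=f\,\nabla^k_XY+(D_Xf)\,Y,\qquad \nabla^k_XY-\nabla^k_YX=[X,Y],\qquad D_X\langle Y,Z\rangle_k=\langle\nabla^k_XY,Z\rangle_k+\langle Y,\nabla^k_XZ\rangle_k,$$ where the existence of the directional derivative on the left of the last identity is part of the claim. Moreover, for all $X,Y\in\mathcal X(\mathcal D)$ and $\eta\in\mathcal D$, $$(\nabla^k_XY)_\eta=[X,Y-Y^R_\eta]_\eta+\tfrac12\Bigl([X^R_\eta,Y^R_\eta]_\eta-B_k(X^R_\eta,Y^R_\eta)_\eta-B_k(Y^R_\eta,X^R_\eta)_\eta\Bigr).$$ -/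

import Mathlib

open Filter Topology MeasureTheory
open scoped ContDiff

noncomputable section

namespace CircleDiff

/-! ## Smooth real functions on the circle `ℝ / ℤ` -/

/-- The circle `𝕊 = ℝ / ℤ`. -/
abbrev S : Type := UnitAddCircle

/-- The real functions on the circle whose pull-back to `ℝ` is `C^∞`, as a linear subspace. -/
def smoothSubmodule : Submodule ℝ (S → ℝ) where
  carrier := {u | ContDiff ℝ ∞ fun x : ℝ => u (x : S)}
  add_mem' {u v} (hu : ContDiff ℝ ∞ fun x : ℝ => u (x : S))
      (hv : ContDiff ℝ ∞ fun x : ℝ => v (x : S)) := hu.add hv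
  zero_mem' := show ContDiff ℝ ∞ fun _ : ℝ => (0 : ℝ) from contDiff_const
  smul_mem' _ u (hu : ContDiff ℝ ∞ fun x : ℝ => u (x : S)) := contDiff_const.smul hu

/-- The space `C^∞(𝕊)` of smooth real functions on the circle. -/
def CS : Type := smoothSubmodule

namespace CS

instance : AddCommGroup CS := inferInstanceAs (AddCommGroup smoothSubmodule)
instance : Module ℝ CS := inferInstanceAs (Module ℝ smoothSubmodule)

/-- The underlying function. -/
def toFun (u : CS) : S → ℝ := Subtype.val (p := (· ∈ smoothSubmodule)) u

/-- A function on the circle with smooth pull-back to `ℝ`, as an element of `C^∞(𝕊)`. -/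
def of (u : S → ℝ) (hu : ContDiff ℝ ∞ fun x : ℝ => u (x : S)) : CS :=
  (⟨u, hu⟩ : smoothSubmodule)

instance : CoeFun CS (fun _ => S → ℝ) := ⟨toFun⟩

@[simp] theorem of_apply (u : S → ℝ) (hu) (x : S) : of u hu x = u x := rfl

theorem ext {u v : CS} (h : ∀ x, u x = v x) : u = v := Subtype.ext (funext h)

@[simp] theorem add_apply (u v : CS) (x : S) : (u + v) x = u x + v x := rfl
@[simp] theorem smul_apply (c : ℝ) (u : CS) (x : S) : (c • u) x = c * u x := rfl

theorem contDiff (u : CS) : ContDiff ℝ ∞ fun x : ℝ => u (x : S) := Subtype.property (p := (· ∈ smoothSubmodule)) u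

theorem continuous (u : CS) : Continuous u.toFun :=
  continuous_coinduced_dom.2 u.contDiff.continuous

theorem periodic_deriv (u : CS) : Function.Periodic (deriv fun x : ℝ => u (x : S)) 1 := by
  intro x
  rw [← deriv_comp_add_const]
  congr 1
  funext y
  simp

/-- The derivative `u ↦ u_x` on `C^∞(𝕊)`. -/
def dx (u : CS) : CS :=
  of u.periodic_deriv.lift (contDiff_infty_iff_deriv.mp u.contDiff).2

@[simp] theorem dx_coe (u : CS) (x : ℝ) : u.dx (x : S) = deriv (fun y : ℝ => u (y : S)) x := rfl

theorem dx_add (u v : CS) : (u + v).dx = u.dx + v.dx := by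
  apply ext
  intro x
  induction x using QuotientAddGroup.induction_on with | H x => ?_
  exact deriv_add (u.contDiff.differentiable (by simp) x) (v.contDiff.differentiable (by simp) x)

theorem dx_smul (c : ℝ) (u : CS) : (c • u).dx = c • u.dx := by
  apply ext
  intro x
  induction x using QuotientAddGroup.induction_on with | H x => ?_
  exact deriv_const_mul c (u.contDiff.differentiable (by simp) x)

/-- The pointwise product of smooth functions. -/
def mul (u v : CS) : CS := of (fun x => u x * v x) (u.contDiff.mul v.contDiff)

/-- All derivatives of a smooth function, as continuous functions on the circle. -/
def jets : CS →ₗ[ℝ] (ℕ → C(S, ℝ)) where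
  toFun u n := ⟨(dx^[n] u).toFun, (dx^[n] u).continuous⟩
  map_add' u v := by
    funext n
    have h : dx^[n] (u + v) = dx^[n] u + dx^[n] v := by
      induction n with
      | zero => rfl
      | succ n ih => simp only [Function.iterate_succ_apply', ih, dx_add]
    ext x
    simp [h]
  map_smul' c u := by
    funext n
    have h : dx^[n] (c • u) = c • dx^[n] u := by
      induction n with
      | zero => rfl
      | succ n ih => simp only [Function.iterate_succ_apply', ih, dx_smul]
    ext x
    simp [h]

/-- The Fréchet topology of `C^∞(𝕊)`: uniform convergence of each derivative. -/
instance : TopologicalSpace CS := TopologicalSpace.induced jets inferInstance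

instance : IsTopologicalAddGroup CS := topologicalAddGroup_induced jets
instance : ContinuousSMul ℝ CS := continuousSMul_induced jets

end CS

/-! ## Differential calculus in topological vector spaces -/

section Calculus

variable {E E' F : Type} [AddCommGroup E] [Module ℝ E] [TopologicalSpace E]
  [AddCommGroup E'] [Module ℝ E'] [TopologicalSpace E']
  [AddCommGroup F] [Module ℝ F] [TopologicalSpace F]

/-- `f` has directional derivative `L` at `x` in the direction `v`. -/
def HasDirDeriv (f : E → F) (x v : E) (L : F) : Prop :=
  Tendsto (fun h : ℝ => h⁻¹ • (f (x + h • v) - f x)) (𝓝[≠] 0) (𝓝 L)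

end Calculus

/-- Differentiability of class `C^n` on an open set `U` of a topological vector space (in the sense
used for Fréchet spaces): `f` is continuous on `U` and, for `n ≥ 1`, all the directional derivatives
`Df(x) v`, `x ∈ U`, exist and the map `(x, v) ↦ Df(x) v` is of class `C^{n-1}` on `U × E`. -/
def CnOn {F : Type} [AddCommGroup F] [Module ℝ F] [TopologicalSpace F] :
    (n : ℕ) → {E : Type} → [AddCommGroup E] → [Module ℝ E] → [TopologicalSpace E] →
      (E → F) → Set E → Prop
  | 0, _, _, _, _, f, U => ContinuousOn f U
  | n + 1, E, _, _, _, f, U => ContinuousOn f U ∧ ∃ f' : E × E → F,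
      (∀ x ∈ U, ∀ v, HasDirDeriv f x v (f' (x, v))) ∧ CnOn n f' (U ×ˢ Set.univ)

section Calculus

variable {E E' F : Type} [AddCommGroup E] [Module ℝ E] [TopologicalSpace E]
  [AddCommGroup E'] [Module ℝ E'] [TopologicalSpace E']
  [AddCommGroup F] [Module ℝ F] [TopologicalSpace F]

theorem CnOn.continuousOn {n : ℕ} {f : E → F} {U : Set E} (h : CnOn n f U) :
    ContinuousOn f U := by
  cases n with
  | zero => exact h
  | succ n => exact h.1

theorem CnOn.of_succ {n : ℕ} : ∀ {E : Type} [AddCommGroup E] [Module ℝ E] [TopologicalSpace E]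
    {f : E → F} {U : Set E}, CnOn (n + 1) f U → CnOn n f U := by
  induction n with
  | zero => intro E _ _ _ f U h; exact h.1
  | succ n ih =>
    intro E _ _ _ f U h
    obtain ⟨h0, f', h1, h2⟩ := h
    exact ⟨h0, f', h1, ih h2⟩

theorem CnOn.comp_linear {n : ℕ} : ∀ {E E' : Type} [AddCommGroup E] [Module ℝ E]
    [TopologicalSpace E] [AddCommGroup E'] [Module ℝ E'] [TopologicalSpace E']
    {f : E → F} {U : Set E} {U' : Set E'} (l : E' →L[ℝ] E),
    CnOn n f U → Set.MapsTo l U' U → CnOn n (fun x => f (l x)) U' := by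
  induction n with
  | zero => intro E E' _ _ _ _ _ _ f U U' l h hl; exact h.comp l.continuous.continuousOn hl
  | succ n ih =>
    intro E E' _ _ _ _ _ _ f U U' l h hl
    obtain ⟨h0, f', h1, h2⟩ := h
    refine ⟨h0.comp l.continuous.continuousOn hl, fun p => f' (l p.1, l p.2), ?_, ?_⟩
    · intro x hx v
      have := h1 (l x) (hl hx) (l v)
      simpa [HasDirDeriv] using this
    · exact ih (l.prodMap l) h2 (fun p hp => ⟨hl hp.1, trivial⟩)

theorem CnOn.const (n : ℕ) : ∀ {E : Type} [AddCommGroup E] [Module ℝ E] [TopologicalSpace E]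
    (c : F) (U : Set E), CnOn n (fun _ => c) U := by
  induction n generalizing F with
  | zero => intro E _ _ _ c U; exact continuousOn_const
  | succ n ih =>
    intro E _ _ _ c U
    exact ⟨continuousOn_const, fun _ => 0, fun x _ v => by simpa [HasDirDeriv] using tendsto_const_nhds, ih 0 _⟩

theorem CnOn.add [IsTopologicalAddGroup F] {n : ℕ} : ∀ {E : Type} [AddCommGroup E] [Module ℝ E]
    [TopologicalSpace E] {f g : E → F} {U : Set E},
    CnOn n f U → CnOn n g U → CnOn n (fun x => f x + g x) U := by
  induction n with
  | zero => intro E _ _ _ f g U hf hg; exact ContinuousOn.add hf hg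
  | succ n ih =>
    intro E _ _ _ f g U hf hg
    obtain ⟨f0, f', f1, f2⟩ := hf
    obtain ⟨g0, g', g1, g2⟩ := hg
    refine ⟨f0.add g0, fun p => f' p + g' p, fun x hx v => ?_, ih f2 g2⟩
    refine ((f1 x hx v).add (g1 x hx v)).congr fun h => ?_
    rw [← smul_add]
    congr 1
    exact (add_sub_add_comm _ _ _ _).symm

theorem CnOn.smul [IsTopologicalAddGroup F] [ContinuousSMul ℝ F] {n : ℕ} :
    ∀ {E : Type} [AddCommGroup E] [Module ℝ E] [TopologicalSpace E]
    {f : E → ℝ} {g : E → F} {U : Set E},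
    CnOn n f U → CnOn n g U → CnOn n (fun x => f x • g x) U := by
  induction n with
  | zero => intro E _ _ _ f g U hf hg; exact ContinuousOn.smul hf hg
  | succ n ih =>
    intro E _ _ _ f g U hf hg
    have hfs := hf.of_succ
    have hgs := hg.of_succ
    obtain ⟨f0, f', f1, f2⟩ := hf
    obtain ⟨g0, g', g1, g2⟩ := hg
    have hfst : Set.MapsTo (ContinuousLinearMap.fst ℝ E E) (U ×ˢ Set.univ) U := fun p hp => hp.1
    refine ⟨f0.smul g0, fun p => f' p • g p.1 + f p.1 • g' p, fun x hx v => ?_,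
      (ih f2 (hgs.comp_linear _ hfst)).add (ih (hfs.comp_linear _ hfst) g2)⟩
    have hh : Tendsto (fun h : ℝ => h) (𝓝[≠] 0) (𝓝 0) := tendsto_id.mono_left nhdsWithin_le_nhds
    have hg' : Tendsto (fun h : ℝ => g (x + h • v)) (𝓝[≠] 0) (𝓝 (g x)) := by
      have := (hh.smul (g1 x hx v)).add_const (g x)
      rw [zero_smul, zero_add] at this
      refine this.congr' ?_
      filter_upwards [self_mem_nhdsWithin] with h hne
      rw [smul_inv_smul₀ hne, sub_add_cancel]
    refine (((f1 x hx v).smul hg').add ((g1 x hx v).const_smul (f x))).congr fun h => ?_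
    simp only [smul_eq_mul, smul_sub, sub_smul, mul_smul, mul_sub]
    rw [smul_comm (f x) h⁻¹ (g (x + h • v)), smul_comm (f x) h⁻¹ (g x)]
    abel

end Calculus

/-! ## The group of orientation-preserving smooth diffeomorphisms of the circle -/

/-- Orientation-preserving `C^∞` diffeomorphisms of the circle: bijections of `ℝ / ℤ` which have a
`C^∞` lift `F : ℝ → ℝ` with `F' > 0` and `F (x + 1) = F x + 1`. -/
structure D where
  /-- the underlying bijection of the circle -/
  toEquiv : S ≃ S
  exists_lift : ∃ F : ℝ → ℝ, ContDiff ℝ ∞ F ∧ (∀ x, 0 < deriv F x) ∧ (∀ x, F (x + 1) = F x + 1) ∧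
    ∀ x : ℝ, toEquiv (x : S) = (F x : S)

namespace D

instance : CoeFun D (fun _ => S → S) := ⟨fun φ => φ.toEquiv⟩

theorem ext {φ ψ : D} (h : ∀ x, φ x = ψ x) : φ = ψ := by
  cases φ; cases ψ; congr 1; exact Equiv.ext h

/-- The identity `Id ∈ 𝒟`. -/
def id : D := ⟨Equiv.refl S, _root_.id, contDiff_id, by simp, by simp, by simp⟩

/-- The inverse of a diffeomorphism. -/
def inv (φ : D) : D := ⟨φ.toEquiv.symm, by
  obtain ⟨F, hF, hF', hF1, hφ⟩ := φ.exists_lift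
  have hmono : StrictMono F := strictMono_of_deriv_pos hF'
  have hint : ∀ (n : ℤ) (x : ℝ), F (x + n) = F x + n := by
    have hp : Function.Periodic (fun x => F x - x) 1 := fun x => by simp only [hF1]; ring
    intro n x
    have := hp.int_mul n x
    simp only [mul_one] at this
    linarith
  have hsurj : Function.Surjective F := by
    intro y
    obtain ⟨s, hs⟩ := φ.toEquiv.surjective (y : S)
    induction s using QuotientAddGroup.induction_on with | H x => ?_
    have h1 : ((F x : ℝ) : S) = (y : S) := by rw [← hφ]; exact hs
    obtain ⟨n, hn⟩ := AddSubgroup.mem_zmultiples_iff.mp (QuotientAddGroup.eq.mp h1)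
    refine ⟨x + n, ?_⟩
    rw [hint]
    simp only [zsmul_eq_mul, mul_one] at hn
    linarith
  let e : ℝ ≃ₜ ℝ := (hmono.orderIsoOfSurjective F hsurj).toHomeomorph
  have he : ∀ x, e x = F x := fun x => rfl
  have hes : ∀ x, F (e.symm x) = x := fun x => e.apply_symm_apply x
  have hd : ∀ x, HasDerivAt F (deriv F x) x := fun x => (hF.differentiable (by simp) x).hasDerivAt
  refine ⟨e.symm, ?_, ?_, ?_, ?_⟩
  · exact e.contDiff_symm_deriv (f' := deriv F) (fun x => (hF' x).ne') hd hF
  · intro x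
    have := (hd (e.symm x)).of_local_left_inverse (g := e.symm) (a := x)
      e.symm.continuous.continuousAt (hF' _).ne' (Eventually.of_forall hes)
    rw [this.deriv]
    exact inv_pos.mpr (hF' _)
  · intro x
    apply hmono.injective
    rw [hes, hF1, hes]
  · intro x
    rw [Equiv.symm_apply_eq, hφ, hes]⟩

/-- `φ + u`: the diffeomorphism `x ↦ φ(x) + u(x)` (equal to `φ` if this is not an element of `𝒟`).
For fixed `φ` it is the inverse `u ↦ φ + u` of the chart of `𝒟` around `φ`. -/
def translate (φ : D) (u : CS) : D :=
  open Classical in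
  if h : ∃ ψ : D, ∀ x, ψ x = φ x + (u x : S) then h.choose else φ

theorem translate_apply {φ ψ : D} {u : CS} (h : ∀ x, ψ x = φ x + (u x : S)) :
    φ.translate u = ψ := by
  have h' : ∃ ψ : D, ∀ x, ψ x = φ x + (u x : S) := ⟨ψ, h⟩
  rw [translate, dif_pos h']
  exact ext fun x => by rw [h, h'.choose_spec]

/-- The image in `C^∞(𝕊)` of the chart of `𝒟` around `φ`: the functions `u` of absolute value less
than `1 / 2` for which `φ + u` is an element of `𝒟`. -/
def chartTarget (φ : D) : Set CS :=
  {u | (∀ x, |u x| < 1 / 2) ∧ ∃ ψ : D, ∀ x, ψ x = φ x + (u x : S)}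

end D

/-- Right translation `R_η* : V ↦ V ∘ η` of tangent vectors. -/
def CS.comp (u : CS) (η : D) : CS :=
  CS.of (fun x => u (η x)) <| by
    obtain ⟨F, hF, -, -, hη⟩ := η.exists_lift
    simp only [hη]
    exact u.contDiff.comp hF

/-! ## Smooth functions and smooth vector fields on `𝒟`

The changes of charts are translations of `C^∞(𝕊)`, so the charts identify each tangent space of
`𝒟` with `C^∞(𝕊)`, and a vector field on `𝒟` is a map `𝒟 → C^∞(𝕊)`. -/

section

variable {F : Type} [AddCommGroup F] [Module ℝ F] [TopologicalSpace F]

/-- A map on `𝒟` with values in a topological vector space is smooth if it is in every chart. -/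
def IsSmooth (f : D → F) : Prop :=
  ∀ (φ : D) (n : ℕ), CnOn n (fun u : CS => f (φ.translate u)) φ.chartTarget

/-- `lim_{h → 0} (f (φ + h u) - f φ) / h = L`. -/
def HasDerivAlong (f : D → F) (φ : D) (u : CS) (L : F) : Prop :=
  Tendsto (fun h : ℝ => h⁻¹ • (f (φ.translate (h • u)) - f φ)) (𝓝[≠] 0) (𝓝 L)

/-- The directional derivative `(D_X f)(φ) = lim_{h → 0} (f (φ + h X(φ)) - f φ) / h`. -/
def derivAlong (X : D → CS) (f : D → F) (φ : D) : F :=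
  limUnder (𝓝[≠] (0 : ℝ)) fun h : ℝ => h⁻¹ • (f (φ.translate (h • X φ)) - f φ)

end

/-- The Lie bracket `[X, Y] = D_X Y - D_Y X` of vector fields on `𝒟`. -/
def bracket (X Y : D → CS) : D → CS := fun φ => derivAlong X Y φ - derivAlong Y X φ

/-- The ring `ℱ(𝒟)` of smooth real functions on `𝒟`. -/
def SmoothFunctions : Subalgebra ℝ (D → ℝ) where
  carrier := {f | IsSmooth f}
  mul_mem' hf hg φ n := (hf φ n).smul (hg φ n)
  add_mem' hf hg φ n := (hf φ n).add (hg φ n)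
  algebraMap_mem' c _ n := CnOn.const n c _

/-- The `ℱ(𝒟)`-module `𝒳(𝒟)` of smooth vector fields on `𝒟`. -/
def SmoothFields : Submodule SmoothFunctions (D → CS) where
  carrier := {X | IsSmooth X}
  add_mem' hX hY φ n := (hX φ n).add (hY φ n)
  zero_mem' _ n := CnOn.const n 0 _
  smul_mem' f _ hX φ n := (f.2 φ n).smul (hX φ n)

instance : CoeFun SmoothFunctions (fun _ => D → ℝ) := ⟨fun f => f.1⟩
instance : CoeFun SmoothFields (fun _ => D → CS) := ⟨fun X => X.1⟩

instance : SMul SmoothFunctions SmoothFields := SmoothFields.module.toSMul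

/-! ## The right-invariant `H^k` metric -/

/-- The inner product `⟨u, v⟩_k = ∑_{i ≤ k} ∫ (∂_x^i u) (∂_x^i v) dx` on `C^∞(𝕊)`. -/
def innerH (k : ℕ) (u v : CS) : ℝ :=
  ∑ i ∈ Finset.range (k + 1), ∫ x : S, (CS.dx^[i] u) x * (CS.dx^[i] v) x

/-- The right-invariant metric `⟨V, W⟩_k = ⟨R_{η⁻¹}* V, R_{η⁻¹}* W⟩_k`, `V, W ∈ T_η 𝒟`. -/
def metric (k : ℕ) (η : D) (V W : CS) : ℝ := innerH k (V.comp η.inv) (W.comp η.inv)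

/-- The operator `A_k = 1 - d²/dx² + ⋯ + (-1)^k d^{2k}/dx^{2k}` on `C^∞(𝕊)`. -/
def A (k : ℕ) (u : CS) : CS := ∑ i ∈ Finset.range (k + 1), (-1 : ℝ) ^ i • CS.dx^[2 * i] u

/-- The operator `B_k(u, v) = -A_k⁻¹ (2 v_x A_k(u) + v A_k(u_x))` on `C^∞(𝕊)`. -/
def B (k : ℕ) (u v : CS) : CS :=
  -Function.invFun (A k) ((2 : ℝ) • v.dx.mul (A k u) + v.mul (A k u.dx))

/-- The right-invariant vector field `X^R_η` whose value at `η` is `V ∈ T_η 𝒟`; its value at a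
point `φ` is `R_φ* R_{η⁻¹}* V`. -/
def rightInv (η : D) (V : CS) : D → CS := fun φ => (V.comp η.inv).comp φ

/-- `B_k` on right-invariant vector fields: `B_k(X, Y)_η = R_η* B_k(X_Id, Y_Id)`. -/
def fieldB (k : ℕ) (X Y : D → CS) : D → CS := fun η => (B k (X D.id) (Y D.id)).comp η

/-! ## Connections -/

/-- A connection (covariant derivative) on `𝒟`: a map `(X, Y) ↦ ∇_X Y` on smooth vector fields
which is `ℱ(𝒟)`-linear in `X`, additive in `Y`, and satisfies `∇_X (f Y) = f ∇_X Y + (X f) Y`. -/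
structure IsConnection (nabla : SmoothFields → SmoothFields → SmoothFields) : Prop where
  add_left : ∀ X X' Y, nabla (X + X') Y = nabla X Y + nabla X' Y
  smul_left : ∀ (f : SmoothFunctions) (X Y), nabla (f • X) Y = f • nabla X Y
  add_right : ∀ X Y Y', nabla X (Y + Y') = nabla X Y + nabla X Y'
  leibniz : ∀ (f : SmoothFunctions) (X Y) (φ : D),
    nabla X (f • Y) φ = f φ • nabla X Y φ + derivAlong X f φ • Y φ

/-- A Riemannian connection for the right-invariant `H^k` metric: torsion-free and compatible with
the metric, `X ⟨Y, Z⟩_k = ⟨∇_X Y, Z⟩_k + ⟨Y, ∇_X Z⟩_k`. -/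
structure IsRiemannianConnection (k : ℕ) (nabla : SmoothFields → SmoothFields → SmoothFields) :
    Prop extends IsConnection nabla where
  torsion_free : ∀ (X Y : SmoothFields) (φ : D),
    nabla X Y φ - nabla Y X φ = bracket X Y φ
  metric_compatible : ∀ (X Y Z : SmoothFields) (φ : D),
    HasDerivAlong (fun ψ => metric k ψ (Y ψ) (Z ψ)) φ (X φ)
      (metric k φ (nabla X Y φ) (Z φ) + metric k φ (Y φ) (nabla X Z φ))

end CircleDiff

end

noncomputable section

namespace CircleDiff

/-! ## The differential calculus of Michal and Bastiani -/

set_option linter.unusedSectionVars false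

section Calculus

variable {E E' F G : Type} [AddCommGroup E] [Module ℝ E] [TopologicalSpace E]
  [AddCommGroup E'] [Module ℝ E'] [TopologicalSpace E']
  [AddCommGroup F] [Module ℝ F] [TopologicalSpace F]
  [AddCommGroup G] [Module ℝ G] [TopologicalSpace G]

/-! The metric is only weak, so nondegeneracy gives uniqueness of the connection but not existence:
the representing vector in Koszul's formula has to be exhibited. It is available because `A k` is
invertible. Pairing with `A k u` in `L²` is the inner product (`innerH_eq`), and one integration by
parts shows that `B k · v` is the adjoint of `z ↦ v z_x - v_x z` (`innerH_B`). Solving Koszul's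
formula at the identity gives the Christoffel operator `Γ(u, v) = ((u v)_x + B(u, v) + B(v, u)) /
2`, and `covDeriv` is `D_X Y - Γ(X ∘ φ⁻¹, Y ∘ φ⁻¹) ∘ φ`.

Torsion vanishes because `Γ` is symmetric. The derivative of `ψ ↦ Y_ψ ∘ ψ⁻¹` along `v` is `(D_v Y) ∘
φ⁻¹ - (Y ∘ φ⁻¹)_x (v ∘ φ⁻¹)`, so compatibility with the metric reduces to the identity
`innerH_christoffel` at the identity of the group. Two Riemannian connections differ by a form
symmetric in one pair of arguments and skew in another, hence by zero.

The analytic work has two sources. First, `covDeriv` must be a smooth field: composition and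
inversion are smooth (`CS.cnOn_shift_univ`, `cnOn_invCoord`), with a chain rule resting on a mean
value theorem from Hahn-Banach. Differentiating a composition costs one derivative, which is
harmless in `C^∞`. Second, `A k` must be bijective with continuous inverse: injectivity and
continuity come from `norm_sq_le_A`, surjectivity from factoring the operator over `ℂ` into
first-order ones. -/

theorem HasDirDeriv.unique [T2Space F] {f : E → F} {x v : E} {L L' : F}
    (h : HasDirDeriv f x v L) (h' : HasDirDeriv f x v L') : L = L' :=
  tendsto_nhds_unique h h'

theorem hasDirDeriv_zero (f : E → F) (x : E) : HasDirDeriv f x 0 0 := by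
  simpa [HasDirDeriv] using tendsto_const_nhds

theorem HasDirDeriv.smul_dir [ContinuousSMul ℝ F] {f : E → F} {x v : E} {L : F}
    (h : HasDirDeriv f x v L) (c : ℝ) : HasDirDeriv f x (c • v) (c • L) := by
  rcases eq_or_ne c 0 with rfl | hc
  · simpa using hasDirDeriv_zero f x
  · have hcm : Tendsto (fun h : ℝ => h * c) (𝓝[≠] 0) (𝓝[≠] 0) := by
      refine tendsto_nhdsWithin_iff.mpr ⟨?_, ?_⟩
      · have : Tendsto (fun h : ℝ => h * c) (𝓝 0) (𝓝 (0 * c)) := tendsto_id.mul_const c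
        rw [zero_mul] at this
        exact this.mono_left nhdsWithin_le_nhds
      · filter_upwards [self_mem_nhdsWithin] with h hh using mul_ne_zero hh hc
    refine ((h.comp hcm).const_smul c).congr fun h => ?_
    rw [smul_smul h c v, Function.comp_apply, smul_smul, mul_inv, mul_comm h⁻¹,
      mul_inv_cancel_left₀ hc]

theorem HasDirDeriv.congr_of_eventuallyEq {f g : E → F} {x v : E} {L : F}
    (h : HasDirDeriv f x v L) (hx : f x = g x)
    (hfg : ∀ᶠ t : ℝ in 𝓝 0, f (x + t • v) = g (x + t • v)) : HasDirDeriv g x v L := by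
  refine Tendsto.congr' ?_ h
  filter_upwards [hfg.filter_mono nhdsWithin_le_nhds] with t ht
  rw [ht, hx]

theorem eventually_line_mem [IsTopologicalAddGroup E] [ContinuousSMul ℝ E] {U : Set E}
    (hU : IsOpen U) {x : E} (hx : x ∈ U) (v : E) : ∀ᶠ t : ℝ in 𝓝 0, x + t • v ∈ U := by
  have hc : Continuous fun t : ℝ => x + t • v := by fun_prop
  exact hc.continuousAt.eventually_mem (by simpa using hU.mem_nhds hx)

theorem HasDirDeriv.tendsto_line [IsTopologicalAddGroup F] [ContinuousSMul ℝ F] {f : E → F}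
    {x v : E} {L : F} (h : HasDirDeriv f x v L) :
    Tendsto (fun t : ℝ => f (x + t • v)) (𝓝[≠] 0) (𝓝 (f x)) := by
  have hh : Tendsto (fun h : ℝ => h) (𝓝[≠] 0) (𝓝 0) := tendsto_id.mono_left nhdsWithin_le_nhds
  have := (hh.smul h).add_const (f x)
  rw [zero_smul, zero_add] at this
  refine this.congr' ?_
  filter_upwards [self_mem_nhdsWithin] with h hne
  rw [smul_inv_smul₀ hne, sub_add_cancel]

/-- The mean value theorem: a difference quotient lies in every closed convex set containing the
directional derivatives along the segment. -/
theorem slope_mem_of_hasDirDeriv [IsTopologicalAddGroup F] [ContinuousSMul ℝ F]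
    [LocallyConvexSpace ℝ F] {f : E → F} {f' : ℝ → F} {y w : E} {N : Set F} (hN : Convex ℝ N)
    (hNc : IsClosed N) {h : ℝ} (hh : h ≠ 0)
    (hd : ∀ s : ℝ, |s| ≤ |h| → HasDirDeriv f (y + s • w) w (f' s))
    (hmem : ∀ s : ℝ, |s| ≤ |h| → f' s ∈ N) :
    h⁻¹ • (f (y + h • w) - f y) ∈ N := by
  by_contra hnot
  -- A continuous functional separates the quotient from `N`; along it the scalar mean value theorem
  -- gives a contradiction.
  obtain ⟨l, u, hlu, hul⟩ := geometric_hahn_banach_closed_point hN hNc hnot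
  have hder : ∀ s : ℝ, |s| ≤ |h| → HasDerivAt (fun s : ℝ => l (f (y + s • w))) (l (f' s)) s := by
    intro s hs
    rw [hasDerivAt_iff_tendsto_slope_zero]
    refine ((l.continuous.tendsto _).comp (hd s hs)).congr fun t => ?_
    simp [add_smul, add_assoc]
  have key : ∀ a b : ℝ, a < b → |a| ≤ |h| → |b| ≤ |h| →
      (l (f (y + b • w)) - l (f (y + a • w))) / (b - a) < u := by
    intro a b hab ha hb
    have hs : ∀ s ∈ Set.Icc a b, |s| ≤ |h| := fun s hs =>
      (abs_le_max_abs_abs hs.1 hs.2).trans (max_le ha hb)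
    obtain ⟨c, hc, hc'⟩ := exists_hasDerivAt_eq_slope (fun s : ℝ => l (f (y + s • w)))
      (fun s => l (f' s)) hab
      (fun s hs' => (hder s (hs s hs')).continuousAt.continuousWithinAt)
      (fun s hs' => hder s (hs s (Set.Ioo_subset_Icc_self hs')))
    rw [← hc']
    exact hlu _ (hmem c (hs c (Set.Ioo_subset_Icc_self hc)))
  have hval : l (h⁻¹ • (f (y + h • w) - f y)) = (l (f (y + h • w)) - l (f y)) / h := by
    rw [map_smul, map_sub, smul_eq_mul, div_eq_inv_mul]
  rw [hval] at hul
  rcases lt_or_gt_of_ne hh with hneg | hpos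
  · have := key h 0 hneg le_rfl (by simp)
    rw [zero_smul, add_zero, zero_sub, div_neg, ← neg_div, neg_sub] at this
    exact lt_asymm this hul
  · have := key 0 h hpos (by simp) le_rfl
    rw [zero_smul, add_zero, sub_zero] at this
    exact lt_asymm this hul

/-- A map with continuous directional derivatives is strictly Hadamard differentiable. -/
theorem tendsto_slope_of_continuousOn [IsTopologicalAddGroup E] [ContinuousSMul ℝ E]
    [IsTopologicalAddGroup F] [ContinuousSMul ℝ F] [LocallyConvexSpace ℝ F]
    {f : E → F} {f' : E × E → F} {U : Set E} (hU : IsOpen U)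
    (hd : ∀ x ∈ U, ∀ v, HasDirDeriv f x v (f' (x, v)))
    (hf' : ContinuousOn f' (U ×ˢ Set.univ)) {x v : E} (hx : x ∈ U) {y w : ℝ → E}
    (hy : Tendsto y (𝓝[≠] 0) (𝓝 x)) (hw : Tendsto w (𝓝[≠] 0) (𝓝 v)) :
    Tendsto (fun h : ℝ => h⁻¹ • (f (y h + h • w h) - f (y h))) (𝓝[≠] 0) (𝓝 (f' (x, v))) := by
  rw [tendsto_iff_forall_eventually_mem]
  intro S hS
  -- The mean value theorem needs a closed convex set inside `S`: a convex neighbourhood `N` is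
  -- taken inside a closed one, and `closure N` serves.
  obtain ⟨T, ⟨hT, hTc⟩, hTS⟩ := (closed_nhds_basis (f' (x, v))).mem_iff.mp hS
  obtain ⟨N, ⟨hN, hNconv⟩, hNT⟩ :=
    (LocallyConvexSpace.convex_basis (𝕜 := ℝ) (f' (x, v))).mem_iff.mp hT
  have hclS : closure N ⊆ S := (closure_minimal hNT hTc).trans hTS
  have hg : ContinuousAt (fun p : E × ℝ × E => f' (p.1 + p.2.1 • p.2.2, p.2.2)) (x, (0 : ℝ), v) := by
    have hxU : U ×ˢ (Set.univ : Set E) ∈ 𝓝 (x, v) := (hU.prod isOpen_univ).mem_nhds ⟨hx, trivial⟩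
    have h1 : ContinuousAt f' (x, v) := hf'.continuousAt hxU
    have h2 : Continuous fun p : E × ℝ × E => (p.1 + p.2.1 • p.2.2, p.2.2) := by fun_prop
    refine ContinuousAt.comp (g := f') (f := fun p : E × ℝ × E => (p.1 + p.2.1 • p.2.2, p.2.2)) ?_
      h2.continuousAt
    simpa using h1
  have hg' : ContinuousAt (fun p : E × ℝ × E => p.1 + p.2.1 • p.2.2) (x, (0 : ℝ), v) := by
    have : Continuous (fun p : E × ℝ × E => p.1 + p.2.1 • p.2.2) := by fun_prop
    exact this.continuousAt
  have hev : ∀ᶠ p : E × ℝ × E in 𝓝 x ×ˢ (𝓝 0 ×ˢ 𝓝 v),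
      p.1 + p.2.1 • p.2.2 ∈ U ∧ f' (p.1 + p.2.1 • p.2.2, p.2.2) ∈ N := by
    rw [← nhds_prod_eq, ← nhds_prod_eq]
    exact (hg'.eventually_mem (by simpa using hU.mem_nhds hx)).and
      (hg.eventually_mem (by simpa using hN))
  obtain ⟨pa, hpa, q, hq, hpq⟩ := eventually_prod_iff.mp hev
  obtain ⟨pb, hpb, pc, hpc, hbc⟩ := eventually_prod_iff.mp hq
  obtain ⟨δ, hδ, hball⟩ := Metric.eventually_nhds_iff.mp hpb
  have hsmall : ∀ᶠ h : ℝ in 𝓝[≠] 0, |h| < δ := by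
    filter_upwards [nhdsWithin_le_nhds (Metric.ball_mem_nhds (0 : ℝ) hδ)] with h hh
    simpa using hh
  filter_upwards [hy.eventually hpa, hw.eventually hpc, hsmall, self_mem_nhdsWithin]
    with h h1 h2 h3 h4
  have hseg : ∀ s : ℝ, |s| ≤ |h| → y h + s • w h ∈ U ∧ f' (y h + s • w h, w h) ∈ N := fun s hs =>
    hpq h1 (hbc (hball (y := s) (by simpa using hs.trans_lt h3)) h2)
  exact hclS (slope_mem_of_hasDirDeriv (f' := fun s => f' (y h + s • w h, w h)) hNconv.closure
    isClosed_closure h4 (fun s hs => hd _ (hseg s hs).1 _)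
    (fun s hs => subset_closure (hseg s hs).2))

/-- Write `g (x + h v) = g x + h w(h)`, where `w(h)` is the difference quotient of `g` and tends to
`L`. The slope of `f` along this moving direction converges by `tendsto_slope_of_continuousOn`. -/
theorem HasDirDeriv.comp [IsTopologicalAddGroup E] [ContinuousSMul ℝ E]
    [IsTopologicalAddGroup F] [ContinuousSMul ℝ F] [LocallyConvexSpace ℝ F]
    {f : E → F} {f' : E × E → F} {U : Set E} (hU : IsOpen U)
    (hd : ∀ x ∈ U, ∀ v, HasDirDeriv f x v (f' (x, v)))
    (hf' : ContinuousOn f' (U ×ˢ Set.univ)) {g : E' → E} {x v : E'} {L : E} (hx : g x ∈ U)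
    (hg : HasDirDeriv g x v L) : HasDirDeriv (fun y => f (g y)) x v (f' (g x, L)) := by
  refine (tendsto_slope_of_continuousOn hU hd hf' hx tendsto_const_nhds hg).congr' ?_
  filter_upwards [self_mem_nhdsWithin] with h hh
  rw [smul_inv_smul₀ hh, add_sub_cancel]

theorem HasDirDeriv.prodMk {f : E → F} {g : E → G} {x v : E} {L : F} {M : G}
    (hf : HasDirDeriv f x v L) (hg : HasDirDeriv g x v M) :
    HasDirDeriv (fun y => (f y, g y)) x v (L, M) :=
  Tendsto.prodMk_nhds hf hg

theorem HasDirDeriv.add [IsTopologicalAddGroup F] {f g : E → F} {x v : E} {L M : F}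
    (hf : HasDirDeriv f x v L) (hg : HasDirDeriv g x v M) :
    HasDirDeriv (fun y => f y + g y) x v (L + M) := by
  refine (Tendsto.add hf hg).congr fun h => ?_
  rw [← smul_add, add_sub_add_comm]

theorem HasDirDeriv.clm_comp {f : E → F} {x v : E} {L : F} (l : F →L[ℝ] G)
    (hf : HasDirDeriv f x v L) : HasDirDeriv (fun y => l (f y)) x v (l L) := by
  refine ((l.continuous.tendsto L).comp hf).congr fun h => ?_
  simp

theorem HasDirDeriv.neg [IsTopologicalAddGroup F] {f : E → F} {x v : E} {L : F}
    (hf : HasDirDeriv f x v L) : HasDirDeriv (fun y => -f y) x v (-L) := by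
  refine (Tendsto.neg hf).congr fun h => ?_
  rw [← smul_neg, neg_sub_neg, neg_sub]

theorem HasDirDeriv.sub [IsTopologicalAddGroup F] {f g : E → F} {x v : E} {L M : F}
    (hf : HasDirDeriv f x v L) (hg : HasDirDeriv g x v M) :
    HasDirDeriv (fun y => f y - g y) x v (L - M) := by
  simpa only [sub_eq_add_neg] using hf.add hg.neg

theorem HasDirDeriv.bilin [IsTopologicalAddGroup F] [ContinuousSMul ℝ F]
    [IsTopologicalAddGroup G] {H : Type} [AddCommGroup H] [Module ℝ H]
    [TopologicalSpace H] [IsTopologicalAddGroup H] [ContinuousSMul ℝ H] (b : G →ₗ[ℝ] H →ₗ[ℝ] F)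
    (hb : Continuous fun p : G × H => b p.1 p.2) {f : E → G} {g : E → H} {x v : E} {L : G} {M : H}
    (hf : HasDirDeriv f x v L) (hg : HasDirDeriv g x v M) :
    HasDirDeriv (fun y => b (f y) (g y)) x v (b L (g x) + b (f x) M) := by
  have h1 : Tendsto (fun h : ℝ => b (h⁻¹ • (f (x + h • v) - f x)) (g (x + h • v))) (𝓝[≠] 0)
      (𝓝 (b L (g x))) :=
    (hb.tendsto (L, g x)).comp (Tendsto.prodMk_nhds hf hg.tendsto_line)
  have h2 : Tendsto (fun h : ℝ => b (f x) (h⁻¹ • (g (x + h • v) - g x))) (𝓝[≠] 0)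
      (𝓝 (b (f x) M)) :=
    (hb.tendsto (f x, M)).comp (Tendsto.prodMk_nhds tendsto_const_nhds hg)
  refine (h1.add h2).congr fun h => ?_
  simp only [map_smul, map_sub, LinearMap.smul_apply, LinearMap.sub_apply]
  rw [← smul_add, sub_add_sub_cancel]

theorem CnOn.congr [IsTopologicalAddGroup E] [ContinuousSMul ℝ E] {n : ℕ} {f g : E → F} {U : Set E}
    (hU : IsOpen U) (hf : CnOn n f U) (hfg : ∀ x ∈ U, f x = g x) : CnOn n g U := by
  cases n with
  | zero => exact ContinuousOn.congr hf fun x hx => (hfg x hx).symm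
  | succ n =>
    obtain ⟨h0, f', h1, h2⟩ := hf
    refine ⟨h0.congr fun x hx => (hfg x hx).symm, f', fun x hx v => ?_, h2⟩
    refine (h1 x hx v).congr_of_eventuallyEq (hfg x hx) ?_
    filter_upwards [eventually_line_mem hU hx v] with t ht using hfg _ ht

theorem CnOn.prodMk {n : ℕ} : ∀ {E : Type} [AddCommGroup E] [Module ℝ E] [TopologicalSpace E]
    {f : E → F} {g : E → G} {U : Set E},
    CnOn n f U → CnOn n g U → CnOn n (fun x => (f x, g x)) U := by
  induction n with
  | zero => intro E _ _ _ f g U hf hg; exact ContinuousOn.prodMk hf hg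
  | succ n ih =>
    intro E _ _ _ f g U hf hg
    obtain ⟨f0, f', f1, f2⟩ := hf
    obtain ⟨g0, g', g1, g2⟩ := hg
    exact ⟨f0.prodMk g0, fun p => (f' p, g' p), fun x hx v => (f1 x hx v).prodMk (g1 x hx v),
      ih f2 g2⟩

theorem CnOn.clm_comp {n : ℕ} (l : F →L[ℝ] G) : ∀ {E : Type} [AddCommGroup E] [Module ℝ E]
    [TopologicalSpace E] {f : E → F} {U : Set E}, CnOn n f U → CnOn n (fun x => l (f x)) U := by
  induction n with
  | zero => intro E _ _ _ f U hf; exact l.continuous.comp_continuousOn hf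
  | succ n ih =>
    intro E _ _ _ f U hf
    obtain ⟨f0, f', f1, f2⟩ := hf
    exact ⟨l.continuous.comp_continuousOn f0, fun p => l (f' p),
      fun x hx v => (f1 x hx v).clm_comp l, ih f2⟩

theorem CnOn.clm (n : ℕ) (l : E →L[ℝ] F) (U : Set E) : CnOn n l U := by
  cases n with
  | zero => exact l.continuous.continuousOn
  | succ n =>
    refine ⟨l.continuous.continuousOn, fun p => l p.2, fun x _ v => ?_, ?_⟩
    · refine tendsto_const_nhds.congr' ?_
      filter_upwards [self_mem_nhdsWithin] with h hh
      rw [map_add, add_sub_cancel_left, map_smul, inv_smul_smul₀ hh]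
    · have : CnOn n (fun x : E => l x) (Set.univ : Set E) := CnOn.clm n l _
      exact this.comp_linear (ContinuousLinearMap.snd ℝ E E) (fun _ _ => trivial)

theorem CnOn.neg [IsTopologicalAddGroup F] {n : ℕ} {f : E → F} {U : Set E} (hf : CnOn n f U) :
    CnOn n (fun x => -f x) U :=
  hf.clm_comp (-ContinuousLinearMap.id ℝ F)

theorem CnOn.sub [IsTopologicalAddGroup F] {n : ℕ} {f g : E → F} {U : Set E} (hf : CnOn n f U)
    (hg : CnOn n g U) : CnOn n (fun x => f x - g x) U := by
  simpa only [sub_eq_add_neg] using hf.add hg.neg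

theorem CnOn.bilin [IsTopologicalAddGroup F] [ContinuousSMul ℝ F]
    [IsTopologicalAddGroup G] {H : Type} [AddCommGroup H] [Module ℝ H]
    [TopologicalSpace H] [IsTopologicalAddGroup H] [ContinuousSMul ℝ H] (b : G →ₗ[ℝ] H →ₗ[ℝ] F)
    (hb : Continuous fun p : G × H => b p.1 p.2) {n : ℕ} :
    ∀ {E : Type} [AddCommGroup E] [Module ℝ E] [TopologicalSpace E] {f : E → G} {g : E → H}
    {U : Set E}, CnOn n f U → CnOn n g U → CnOn n (fun x => b (f x) (g x)) U := by
  induction n with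
  | zero =>
    intro E _ _ _ f g U hf hg
    exact hb.comp_continuousOn (ContinuousOn.prodMk hf hg)
  | succ n ih =>
    intro E _ _ _ f g U hf hg
    have hfs := hf.of_succ
    have hgs := hg.of_succ
    obtain ⟨f0, f', f1, f2⟩ := hf
    obtain ⟨g0, g', g1, g2⟩ := hg
    have hfst : Set.MapsTo (ContinuousLinearMap.fst ℝ E E) (U ×ˢ Set.univ) U := fun p hp => hp.1
    exact ⟨hb.comp_continuousOn (f0.prodMk g0), fun p => b (f' p) (g p.1) + b (f p.1) (g' p),
      fun x hx v => (f1 x hx v).bilin b hb (g1 x hx v),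
      (ih f2 (hgs.comp_linear _ hfst)).add (ih (hfs.comp_linear _ hfst) g2)⟩

/-- The chain rule. -/
theorem CnOn.comp [IsTopologicalAddGroup F] [ContinuousSMul ℝ F] [LocallyConvexSpace ℝ F] {n : ℕ} :
    ∀ {E E' : Type} [AddCommGroup E] [Module ℝ E] [TopologicalSpace E]
    [AddCommGroup E'] [Module ℝ E'] [TopologicalSpace E']
    [IsTopologicalAddGroup E] [ContinuousSMul ℝ E]
    {f : E → F} {g : E' → E} {U : Set E} {V : Set E'}, IsOpen U →
    CnOn n f U → CnOn n g V → Set.MapsTo g V U → CnOn n (fun x => f (g x)) V := by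
  induction n with
  | zero =>
    intro E E' _ _ _ _ _ _ _ _ f g U V _ hf hg hm
    exact ContinuousOn.comp hf hg hm
  | succ n ih =>
    intro E E' _ _ _ _ _ _ _ _ f g U V hU hf hg hm
    have hgs := hg.of_succ
    obtain ⟨f0, f', f1, f2⟩ := hf
    obtain ⟨g0, g', g1, g2⟩ := hg
    refine ⟨f0.comp g0 hm, fun p => f' (g p.1, g' p),
      fun x hx v => (g1 x hx v).comp hU f1 f2.continuousOn (hm hx), ?_⟩
    refine ih (g := fun p : E' × E' => (g p.1, g' p)) (hU.prod isOpen_univ) f2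
      (CnOn.prodMk ?_ g2) fun p hp => ⟨hm hp.1, trivial⟩
    exact hgs.comp_linear (ContinuousLinearMap.fst ℝ E' E') fun p hp => hp.1

/-- `CnOn` hides the derivative behind an existential; uniqueness of limits identifies it with an
explicitly known value `M`. -/
theorem CnOn.hasDirDeriv_comp [IsTopologicalAddGroup E] [ContinuousSMul ℝ E]
    [IsTopologicalAddGroup F] [ContinuousSMul ℝ F] [LocallyConvexSpace ℝ F] [T2Space F] {f : E → F}
    {U : Set E} (hU : IsOpen U) (hf : CnOn 1 f U) {g : E' → E} {x v : E'} {L : E} {M : F}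
    (hx : g x ∈ U) (hfL : HasDirDeriv f (g x) L M) (hg : HasDirDeriv g x v L) :
    HasDirDeriv (fun y => f (g y)) x v M := by
  obtain ⟨_, f', f1, f2⟩ := hf
  rw [hfL.unique (f1 _ hx L)]
  exact hg.comp hU f1 f2 hx

/-- The directional derivatives of a `C¹` map are additive in the direction. -/
theorem CnOn.hasDirDeriv_add [IsTopologicalAddGroup E] [ContinuousSMul ℝ E]
    [IsTopologicalAddGroup F] [ContinuousSMul ℝ F] [LocallyConvexSpace ℝ F] [T2Space F] {f : E → F}
    {U : Set E} (hU : IsOpen U) (hf : CnOn 1 f U) {x v w : E} {L M : F} (hx : x ∈ U)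
    (hv : HasDirDeriv f x v L) (hw : HasDirDeriv f x w M) : HasDirDeriv f x (v + w) (L + M) := by
  obtain ⟨_, f', f1, f2⟩ := hf
  rw [hw.unique (f1 _ hx w)]
  have hy : Tendsto (fun h : ℝ => x + h • v) (𝓝[≠] 0) (𝓝 x) := by
    have hc : Continuous fun t : ℝ => x + t • v := by fun_prop
    simpa using (hc.tendsto 0).mono_left (nhdsWithin_le_nhds (s := {(0 : ℝ)}ᶜ))
  -- The increment along `v + w` is cut at `x + h v`; the second piece has a moving base point.
  refine (Tendsto.add hv (tendsto_slope_of_continuousOn hU f1 f2 hx hy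
    (tendsto_const_nhds (x := w)))).congr fun h => ?_
  rw [← smul_add, smul_add h v w, ← add_assoc, add_comm, sub_add_sub_cancel]

end Calculus

/-! ## The Fréchet space of smooth functions -/

namespace CS

@[simp] theorem zero_apply (x : S) : (0 : CS) x = 0 := rfl
@[simp] theorem neg_apply (u : CS) (x : S) : (-u) x = -u x := rfl
@[simp] theorem sub_apply (u v : CS) (x : S) : (u - v) x = u x - v x := rfl
@[simp] theorem mul_apply (u v : CS) (x : S) : u.mul v x = u x * v x := rfl

theorem jets_injective : Function.Injective jets := fun _ _ h =>
  ext fun x => DFunLike.congr_fun (congr_fun h 0) x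

theorem isInducing_jets : IsInducing jets := ⟨rfl⟩

instance : T2Space CS := (IsEmbedding.mk isInducing_jets jets_injective).t2Space

instance : LocallyConvexSpace ℝ CS := LocallyConvexSpace.induced jets

theorem hasDerivAt (u : CS) (x : ℝ) : HasDerivAt (fun y : ℝ => u (y : S)) (u.dx (x : S)) x :=
  (u.contDiff.differentiable (by simp) x).hasDerivAt

theorem dx_apply_eq {u : CS} {x : ℝ} {c : ℝ} (h : HasDerivAt (fun y : ℝ => u (y : S)) c x) :
    u.dx (x : S) = c :=
  (u.hasDerivAt x).unique h

/-- The derivative as a linear map. -/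
def dxₗ : CS →ₗ[ℝ] CS where
  toFun := dx
  map_add' := dx_add
  map_smul' := dx_smul

theorem dx_sub (u v : CS) : (u - v).dx = u.dx - v.dx := map_sub dxₗ u v
theorem dx_neg (u : CS) : (-u).dx = -u.dx := map_neg dxₗ u

/-- The product of smooth functions as a bilinear map. -/
def mulₗ : CS →ₗ[ℝ] CS →ₗ[ℝ] CS :=
  LinearMap.mk₂ ℝ mul (fun u v w => ext fun x => by simp [add_mul])
    (fun c u v => ext fun x => by simp [mul_assoc])
    (fun u v w => ext fun x => by simp [mul_add])
    (fun c u v => ext fun x => by simp [mul_left_comm])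

@[simp] theorem mulₗ_apply (u v : CS) : mulₗ u v = u.mul v := rfl

theorem mul_comm (u v : CS) : u.mul v = v.mul u := ext fun x => by simp [_root_.mul_comm]

theorem dx_mul (u v : CS) : (u.mul v).dx = u.dx.mul v + u.mul v.dx := by
  apply ext
  intro x
  induction x using QuotientAddGroup.induction_on with | H x => ?_
  exact dx_apply_eq ((u.hasDerivAt x).mul (v.hasDerivAt x))

/-- The constant function `1`. -/
def one : CS := of (fun _ => 1) contDiff_const

@[simp] theorem one_apply (x : S) : one x = 1 := rfl

theorem dx_one : one.dx = 0 := by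
  apply ext
  intro x
  induction x using QuotientAddGroup.induction_on with | H x => ?_
  exact dx_apply_eq (hasDerivAt_const x (1 : ℝ))

/-- The underlying continuous function. -/
def toC (u : CS) : C(S, ℝ) := ⟨u.toFun, u.continuous⟩

@[simp] theorem toC_apply (u : CS) (x : S) : u.toC x = u x := rfl

/-! ### Convergence of finitely many derivatives -/

/-- Uniform convergence of the derivatives of order at most `n`. -/
def TendstoC {ι : Type*} (n : ℕ) (g : ι → CS) (l : Filter ι) (L : CS) : Prop :=
  ∀ i ≤ n, Tendsto (fun t => jets (g t) i) l (𝓝 (jets L i))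

section TendstoC

variable {ι : Type*} {l : Filter ι} {n : ℕ} {f g : ι → CS} {L M : CS}

theorem tendsto_iff : Tendsto f l (𝓝 L) ↔ ∀ n, TendstoC n f l L := by
  rw [isInducing_jets.tendsto_nhds_iff, tendsto_pi_nhds]
  exact ⟨fun h n i _ => h i, fun h i => h i i le_rfl⟩

theorem tendstoC_zero : TendstoC 0 f l L ↔ Tendsto (fun t => (f t).toC) l (𝓝 L.toC) :=
  ⟨fun h => h 0 le_rfl, fun h i hi => by obtain rfl := Nat.le_zero.mp hi; exact h⟩

/-- This drives the inductions on the order: uniform convergence, plus convergence one order lower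
for the derivatives. -/
theorem tendstoC_succ : TendstoC (n + 1) f l L ↔
    TendstoC 0 f l L ∧ TendstoC n (fun t => (f t).dx) l L.dx := by
  constructor
  · intro h
    refine ⟨fun i hi => h i (hi.trans (Nat.zero_le _)), fun i hi => ?_⟩
    exact h (i + 1) (Nat.succ_le_succ hi)
  · rintro ⟨h0, h1⟩ i hi
    cases i with
    | zero => exact h0 0 le_rfl
    | succ i => exact h1 i (Nat.le_of_succ_le_succ hi)

theorem TendstoC.mono {m : ℕ} (h : TendstoC n f l L) (hm : m ≤ n) : TendstoC m f l L :=
  fun i hi => h i (hi.trans hm)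

theorem tendstoC_const (n : ℕ) (L : CS) : TendstoC n (fun _ => L) l L :=
  fun _ _ => tendsto_const_nhds

theorem TendstoC.add (hf : TendstoC n f l L) (hg : TendstoC n g l M) :
    TendstoC n (fun t => f t + g t) l (L + M) := fun i hi => by
  simpa only [map_add, Pi.add_apply] using (hf i hi).add (hg i hi)

theorem TendstoC.neg (hf : TendstoC n f l L) : TendstoC n (fun t => -f t) l (-L) := fun i hi => by
  simpa only [map_neg, Pi.neg_apply] using (hf i hi).neg

theorem TendstoC.sub (hf : TendstoC n f l L) (hg : TendstoC n g l M) :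
    TendstoC n (fun t => f t - g t) l (L - M) := by
  simpa only [sub_eq_add_neg] using hf.add hg.neg

theorem TendstoC.mul (hf : TendstoC n f l L) (hg : TendstoC n g l M) :
    TendstoC n (fun t => (f t).mul (g t)) l (L.mul M) := by
  induction n generalizing f g L M with
  | zero =>
    rw [tendstoC_zero] at *
    exact Tendsto.mul hf hg
  | succ n ih =>
    have hf' := tendstoC_succ.mp hf
    have hg' := tendstoC_succ.mp hg
    refine tendstoC_succ.mpr ⟨?_, ?_⟩
    · rw [tendstoC_zero] at *
      exact Tendsto.mul hf'.1 hg'.1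
    · simp only [dx_mul]
      exact (ih hf'.2 (hg.mono n.le_succ)).add (ih (hf.mono n.le_succ) hg'.2)

/-- Uniform convergence is continuity of inversion at a unit of the Banach algebra `C(S, ℝ)`. Higher
orders follow from `r' = -f' r²`, which involves `r` to one order less. -/
theorem TendstoC.of_mul_eq_one {r : ι → CS} {R : CS} (hf : TendstoC n f l L)
    (hr : ∀ᶠ t in l, (f t).mul (r t) = one) (hR : L.mul R = one) : TendstoC n r l R := by
  have h0 : TendstoC 0 r l R := by
    rw [tendstoC_zero]
    have h := tendstoC_zero.mp (hf.mono (Nat.zero_le _))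
    have inv : ∀ {u v : CS}, u.mul v = one → u.toC * v.toC = 1 := fun {u v} h => by
      ext x
      exact congr_arg (fun w : CS => w x) h
    have hRi : Ring.inverse L.toC = R.toC :=
      Ring.inverse_unit (⟨L.toC, R.toC, inv hR, by rw [_root_.mul_comm]; exact inv hR⟩ : C(S, ℝ)ˣ)
    have hc : ContinuousAt Ring.inverse L.toC := NormedRing.inverse_continuousAt
      (⟨L.toC, R.toC, inv hR, by rw [_root_.mul_comm]; exact inv hR⟩ : C(S, ℝ)ˣ)
    have := hc.tendsto.comp h
    rw [hRi] at this
    refine this.congr' ?_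
    filter_upwards [hr] with t ht
    exact Ring.inverse_unit
      (⟨(f t).toC, (r t).toC, inv ht, by rw [_root_.mul_comm]; exact inv ht⟩ : C(S, ℝ)ˣ)
  have hdx : ∀ {u v : CS}, u.mul v = one → v.dx = -(u.dx.mul (v.mul v)) := fun {u v} h => by
    apply ext
    intro x
    have h1 : u x * v x = 1 := congr_arg (fun w : CS => w x) h
    have h2 : u.dx x * v x + u x * v.dx x = 0 := by
      have := congr_arg (fun w : CS => w.dx x) h
      simpa [dx_mul, dx_one] using this
    simp only [neg_apply, mul_apply]
    linear_combination v x * h2 - v.dx x * h1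
  induction n with
  | zero => exact h0
  | succ n ih =>
    refine tendstoC_succ.mpr ⟨h0, ?_⟩
    have hn := ih (hf.mono n.le_succ)
    rw [hdx hR]
    intro i hi
    refine (((tendstoC_succ.mp hf).2.mul (hn.mul hn)).neg i hi).congr' ?_
    filter_upwards [hr] with t ht
    rw [hdx ht]

end TendstoC

/-- The derivative as a continuous linear map. -/
def dxL : CS →L[ℝ] CS where
  toLinearMap := dxₗ
  cont := by
    refine continuous_iff_continuousAt.mpr fun u => tendsto_iff.mpr fun n => ?_
    exact (tendstoC_succ.mp (tendsto_iff.mp tendsto_id (n + 1))).2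

@[simp] theorem dxL_apply (u : CS) : dxL u = u.dx := rfl

theorem continuous_mul : Continuous fun p : CS × CS => mulₗ p.1 p.2 :=
  continuous_iff_continuousAt.mpr fun p => tendsto_iff.mpr fun n =>
    (tendsto_iff.mp (continuous_fst.tendsto p) n).mul (tendsto_iff.mp (continuous_snd.tendsto p) n)

/-! ### Composition with `x ↦ x + u x` -/

/-- The composition `x ↦ v (x + u x)`. -/
def shift (v u : CS) : CS := of (fun x => v (x + (u x : S))) <| by
  simp only [← AddCircle.coe_add]
  exact v.contDiff.comp (contDiff_id.add u.contDiff)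

@[simp] theorem shift_apply (v u : CS) (x : S) : v.shift u x = v (x + (u x : S)) := rfl

theorem smul_shift (c : ℝ) (v u : CS) : (c • v).shift u = c • v.shift u := rfl
theorem shift_zero (v : CS) : v.shift 0 = v := ext fun x => by simp

theorem dx_shift (v u : CS) : (v.shift u).dx = (v.dx.shift u).mul (one + u.dx) := by
  apply ext
  intro x
  induction x using QuotientAddGroup.induction_on with | H x => ?_
  have h : HasDerivAt (fun y : ℝ => y + u (y : S)) (1 + u.dx (x : S)) x :=
    (hasDerivAt_id x).add (u.hasDerivAt x)
  have h' := (v.hasDerivAt (x + u (x : S))).comp x h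
  exact dx_apply_eq (u := v.shift u) h'

/-- At order zero this is continuity of composition in the compact-open topology; `dx_shift` lifts
it to higher orders. -/
theorem TendstoC.shift {ι : Type*} {l : Filter ι} {n : ℕ} {v u : ι → CS} {V U : CS}
    (hv : TendstoC n v l V) (hu : TendstoC n u l U) :
    TendstoC n (fun t => (v t).shift (u t)) l (V.shift U) := by
  have zero : ∀ {v : ι → CS} {V : CS}, TendstoC 0 v l V → TendstoC 0 u l U →
      TendstoC 0 (fun t => (v t).shift (u t)) l (V.shift U) := by
    intro v V hv hu
    rw [tendstoC_zero] at *
    let k : C(ℝ, S) := ⟨fun x => x, AddCircle.continuous_mk' 1⟩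
    have h1 : Tendsto (fun t => ContinuousMap.id S + k.comp (u t).toC) l
        (𝓝 (ContinuousMap.id S + k.comp U.toC)) :=
      tendsto_const_nhds.add (Tendsto.compCM tendsto_const_nhds hu)
    exact Tendsto.compCM hv h1
  induction n generalizing v V with
  | zero => exact zero hv hu
  | succ n ih =>
    refine tendstoC_succ.mpr ⟨zero (hv.mono (Nat.zero_le _)) (hu.mono (Nat.zero_le _)), ?_⟩
    simp only [dx_shift]
    exact (ih (tendstoC_succ.mp hv).2 (hu.mono n.le_succ)).mul
      ((tendstoC_const n one).add (tendstoC_succ.mp hu).2)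

theorem continuous_shift : Continuous fun p : CS × CS => p.1.shift p.2 :=
  continuous_iff_continuousAt.mpr fun p => tendsto_iff.mpr fun n =>
    (tendsto_iff.mp (continuous_fst.tendsto p) n).shift
      (tendsto_iff.mp (continuous_snd.tendsto p) n)

theorem abs_apply_le_norm (u : CS) (x : S) : |u x| ≤ ‖u.toC‖ := by
  simpa using u.toC.norm_coe_le_norm x

theorem abs_sub_le_norm_dx (v : CS) (y s : ℝ) :
    |v ((y + s : ℝ) : S) - v (y : S)| ≤ ‖v.dx.toC‖ * |s| := by
  have := Convex.norm_image_sub_le_of_norm_hasDerivWithin_le (f := fun y : ℝ => v (y : S))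
    (f' := fun y : ℝ => v.dx (y : S)) (s := Set.univ) (C := ‖v.dx.toC‖) (x := y) (y := y + s)
    (fun x _ => (v.hasDerivAt x).hasDerivWithinAt) (fun x _ => v.dx.abs_apply_le_norm x)
    convex_univ trivial trivial
  simpa using this

/-- The mean value inequality for `t ↦ v (y + t) - t v'(y)`; the sharp factor `1 / 2` is not needed.
-/
theorem abs_taylor_le (v : CS) (y s : ℝ) :
    |v ((y + s : ℝ) : S) - v (y : S) - s * v.dx (y : S)| ≤ ‖v.dx.dx.toC‖ * |s| * |s| := by
  have := Convex.norm_image_sub_le_of_norm_hasDerivWithin_le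
    (f := fun t : ℝ => v ((y + t : ℝ) : S) - t * v.dx (y : S))
    (f' := fun t : ℝ => v.dx ((y + t : ℝ) : S) - v.dx (y : S)) (s := Set.uIcc 0 s)
    (C := ‖v.dx.dx.toC‖ * |s|) (x := 0) (y := s) (fun t _ => ?_) (fun t ht => ?_)
    (convex_uIcc 0 s) Set.left_mem_uIcc Set.right_mem_uIcc
  · simpa [sub_right_comm] using this
  · have h1 : HasDerivAt (fun t : ℝ => v ((y + t : ℝ) : S)) (v.dx ((y + t : ℝ) : S)) t :=
      (v.hasDerivAt (y + t)).comp_const_add y t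
    have h2 : HasDerivAt (fun t : ℝ => t * v.dx (y : S)) (v.dx (y : S)) t := by
      simpa using (hasDerivAt_id t).mul_const (v.dx (y : S))
    exact (h1.sub h2).hasDerivWithinAt
  · refine (v.dx.abs_sub_le_norm_dx y t).trans ?_
    refine mul_le_mul_of_nonneg_left ?_ (norm_nonneg _)
    simpa using Set.abs_sub_left_of_mem_uIcc ht

/-- At order zero the Taylor remainder is `O(h²)` uniformly in the point. Higher orders go by
induction with `v` replaced by `v.dx`. -/
theorem hasDirDeriv_shift_right (v u w : CS) :
    HasDirDeriv (fun u => v.shift u) u w ((v.dx.shift u).mul w) := by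
  have hline : Tendsto (fun h : ℝ => u + h • w) (𝓝[≠] 0) (𝓝 u) := by
    have hc : Continuous fun t : ℝ => u + t • w := by fun_prop
    simpa using (hc.tendsto 0).mono_left (nhdsWithin_le_nhds (s := {(0 : ℝ)}ᶜ))
  have zero : ∀ v : CS, TendstoC 0 (fun h : ℝ => h⁻¹ • (v.shift (u + h • w) - v.shift u)) (𝓝[≠] 0)
      ((v.dx.shift u).mul w) := by
    intro v
    rw [tendstoC_zero, tendsto_iff_norm_sub_tendsto_zero]
    have hb : Tendsto (fun h : ℝ => ‖v.dx.dx.toC‖ * ‖w.toC‖ ^ 2 * |h|) (𝓝[≠] 0) (𝓝 0) := by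
      have hc : Continuous fun h : ℝ => ‖v.dx.dx.toC‖ * ‖w.toC‖ ^ 2 * |h| := by fun_prop
      simpa using (hc.tendsto 0).mono_left (nhdsWithin_le_nhds (s := {(0 : ℝ)}ᶜ))
    refine squeeze_zero' (Eventually.of_forall fun _ => norm_nonneg _) ?_ hb
    filter_upwards [self_mem_nhdsWithin] with h hh
    have hh : h ≠ 0 := hh
    rw [ContinuousMap.norm_le _ (by positivity)]
    intro x
    induction x using QuotientAddGroup.induction_on with | H x => ?_
    have ht := v.abs_taylor_le (x + u (x : S)) (h * w (x : S))
    have hw := w.abs_apply_le_norm (x : S)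
    have e : (h⁻¹ • (v.shift (u + h • w) - v.shift u)).toC (x : S) -
        ((v.dx.shift u).mul w).toC (x : S) =
        h⁻¹ * (v ((x + u (x : S) + h * w (x : S) : ℝ) : S) - v ((x + u (x : S) : ℝ) : S) -
          h * w (x : S) * v.dx ((x + u (x : S) : ℝ) : S)) := by
      simp only [toC_apply, smul_apply, sub_apply, shift_apply, mul_apply, add_apply,
        AddCircle.coe_add, add_assoc]
      field_simp
    calc ‖(h⁻¹ • (v.shift (u + h • w) - v.shift u)).toC (x : S) -
          ((v.dx.shift u).mul w).toC (x : S)‖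
        ≤ |h|⁻¹ * (‖v.dx.dx.toC‖ * |h * w (x : S)| * |h * w (x : S)|) := by
          rw [e, norm_mul, norm_inv, Real.norm_eq_abs, Real.norm_eq_abs]
          gcongr
      _ = ‖v.dx.dx.toC‖ * |w (x : S)| ^ 2 * |h| := by
          rw [abs_mul]
          field_simp
      _ ≤ ‖v.dx.dx.toC‖ * ‖w.toC‖ ^ 2 * |h| := by gcongr
  refine tendsto_iff.mpr fun n => ?_
  induction n generalizing v with
  | zero => exact zero v
  | succ n ih =>
    refine tendstoC_succ.mpr ⟨zero v, ?_⟩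
    -- The derivative of the quotient is the quotient for `v.dx` times `1 + u.dx`, plus
    -- `(v.dx).shift (u + h • w)` times `w.dx`.
    have h1 := ((ih v.dx).mul (tendstoC_const n (one + u.dx))).add
      (((tendstoC_const n v.dx).shift (tendsto_iff.mp hline n)).mul (tendstoC_const n w.dx))
    have e : ((v.dx.shift u).mul w).dx =
        ((v.dx.dx.shift u).mul w).mul (one + u.dx) + (v.dx.shift u).mul w.dx := by
      rw [dx_mul, dx_shift]
      exact ext fun x => by simp only [add_apply, mul_apply]; ring
    rw [e]
    intro i hi
    refine (h1 i hi).congr' ?_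
    filter_upwards [self_mem_nhdsWithin] with h hh
    have hh : h ≠ 0 := hh
    refine congr_arg (fun z => jets z i) ?_
    rw [dx_smul, dx_sub, dx_shift, dx_shift, dx_add, dx_smul]
    refine ext fun x => ?_
    simp only [add_apply, mul_apply, smul_apply, sub_apply]
    field_simp
    ring

theorem hasDirDeriv_shift (p q : CS × CS) :
    HasDirDeriv (fun p : CS × CS => p.1.shift p.2) p q
      (q.1.shift p.2 + (p.1.dx.shift p.2).mul q.2) := by
  have h1 : Tendsto (fun h : ℝ => q.1.shift (p.2 + h • q.2)) (𝓝[≠] 0) (𝓝 (q.1.shift p.2)) := by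
    have hc : Continuous fun h : ℝ => q.1.shift (p.2 + h • q.2) :=
      continuous_shift.comp (by fun_prop : Continuous fun h : ℝ => (q.1, p.2 + h • q.2))
    simpa using (hc.tendsto 0).mono_left (nhdsWithin_le_nhds (s := {(0 : ℝ)}ᶜ))
  refine (Tendsto.add h1 (hasDirDeriv_shift_right p.1 p.2 q.2)).congr' ?_
  filter_upwards [self_mem_nhdsWithin] with h hh
  have hh : h ≠ 0 := hh
  refine ext fun x => ?_
  simp only [Prod.fst_add, Prod.snd_add, Prod.smul_fst, Prod.smul_snd, add_apply, smul_apply,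
    sub_apply, shift_apply]
  field_simp
  ring

theorem cnOn_mul {n : ℕ} {E : Type} [AddCommGroup E] [Module ℝ E] [TopologicalSpace E]
    {f g : E → CS} {U : Set E} (hf : CnOn n f U) (hg : CnOn n g U) :
    CnOn n (fun x => (f x).mul (g x)) U :=
  CnOn.bilin mulₗ continuous_mul hf hg

/-- The derivative is again made of shifts, products and `v.dx`. The induction closes because `dx`
is a continuous operator on `CS`, so losing a derivative costs nothing. -/
theorem cnOn_shift_univ (n : ℕ) : CnOn n (fun p : CS × CS => p.1.shift p.2) Set.univ := by
  induction n with
  | zero => exact continuous_shift.continuousOn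
  | succ n ih =>
    let fst : CS × CS →L[ℝ] CS := ContinuousLinearMap.fst ℝ CS CS
    let snd : CS × CS →L[ℝ] CS := ContinuousLinearMap.snd ℝ CS CS
    let Fst : (CS × CS) × (CS × CS) →L[ℝ] CS × CS := ContinuousLinearMap.fst ℝ _ _
    let Snd : (CS × CS) × (CS × CS) →L[ℝ] CS × CS := ContinuousLinearMap.snd ℝ _ _
    refine ⟨continuous_shift.continuousOn,
      fun r => r.2.1.shift r.1.2 + (r.1.1.dx.shift r.1.2).mul r.2.2,
      fun p _ q => hasDirDeriv_shift p q, CnOn.add ?_ (cnOn_mul ?_ ?_)⟩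
    · exact ih.comp_linear ((fst.comp Snd).prod (snd.comp Fst)) fun _ _ => trivial
    · exact ih.comp_linear ((dxL.comp (fst.comp Fst)).prod (snd.comp Fst)) fun _ _ => trivial
    · exact CnOn.clm n (snd.comp Snd) _

theorem cnOn_shift {n : ℕ} {E : Type} [AddCommGroup E] [Module ℝ E] [TopologicalSpace E]
    {f g : E → CS} {U : Set E} (hf : CnOn n f U) (hg : CnOn n g U) :
    CnOn n (fun x => (f x).shift (g x)) U :=
  CnOn.comp (f := fun p : CS × CS => p.1.shift p.2) (g := fun x => (f x, g x)) isOpen_univ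
    (cnOn_shift_univ n) (hf.prodMk hg) fun _ _ => trivial

theorem hasDirDeriv_shift_comp {E : Type} [AddCommGroup E] [Module ℝ E]
    {f g : E → CS} {x v : E} {L M : CS} (hf : HasDirDeriv f x v L) (hg : HasDirDeriv g x v M) :
    HasDirDeriv (fun x => (f x).shift (g x)) x v (L.shift (g x) + ((f x).dx.shift (g x)).mul M) := by
  -- Directional derivatives do not see the topology of the source, so any topology will do for the
  -- chain rule.
  let _ : TopologicalSpace E := ⊥
  exact CnOn.hasDirDeriv_comp (f := fun p : CS × CS => p.1.shift p.2) (g := fun x => (f x, g x))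
    isOpen_univ (cnOn_shift_univ 1) trivial (hasDirDeriv_shift (f x, g x) (L, M)) (hf.prodMk hg)

end CS

/-! ## The global coordinate `u ↦ Id + u` on the diffeomorphism group -/

namespace CS

/-- The functions `u` for which `Id + u` is an orientation-preserving diffeomorphism. -/
def diffDomain : Set CS := {u | ∀ x, 0 < 1 + u.dx x}

theorem continuous_toC : Continuous toC :=
  continuous_iff_continuousAt.mpr fun _ => tendstoC_zero.mp (tendsto_iff.mp tendsto_id 0)

theorem isOpen_setOf_forall_mem {O : Set ℝ} (hO : IsOpen O) : IsOpen {u : CS | ∀ x, u x ∈ O} := by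
  have := (ContinuousMap.isOpen_setOfPred_mapsTo (isCompact_univ (X := S)) hO).preimage
    continuous_toC
  convert this using 1
  ext u
  simp [Set.MapsTo]

theorem isOpen_diffDomain : IsOpen diffDomain := by
  have := (isOpen_setOf_forall_mem (isOpen_Ioi (a := (-1 : ℝ)))).preimage dxL.continuous
  convert this using 1
  ext u
  simp [diffDomain, neg_lt_iff_pos_add']

end CS

open CS

/-- The diffeomorphism `Id + u`. -/
def toD (u : CS) : D := D.id.translate u

theorem D.exists_toFun_eq (φ : D) : ∃ u : CS, ∀ x, φ x = x + (u x : S) := by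
  obtain ⟨F, hF, -, hF1, hφ⟩ := φ.exists_lift
  have hp : Function.Periodic (fun x => F x - x) 1 := fun x => by simp only [hF1]; ring
  refine ⟨CS.of hp.lift (hF.sub contDiff_id), fun x => ?_⟩
  induction x using QuotientAddGroup.induction_on with | H x => ?_
  change φ (x : S) = (x : S) + ((F x - x : ℝ) : S)
  rw [hφ, ← AddCircle.coe_add, add_sub_cancel]

/-- The given lift `F` and `x + u x` differ by a continuous integer-valued function, hence by a
constant, so they have the same positive derivative. -/
theorem D.mem_diffDomain {φ : D} {u : CS} (h : ∀ x, φ x = x + (u x : S)) : u ∈ diffDomain := by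
  obtain ⟨F, hF, hF', -, hφ⟩ := φ.exists_lift
  have hd : ∀ x : ℝ, HasDerivAt (fun y : ℝ => F y - (y + u (y : S)))
      (deriv F x - (1 + u.dx (x : S))) x := fun x =>
    (hF.differentiable (by simp) x).hasDerivAt.sub ((hasDerivAt_id x).add (u.hasDerivAt x))
  have hint : ∀ x : ℝ, ∃ n : ℤ, (n : ℝ) = F x - (x + u (x : S)) := by
    intro x
    have h1 : ((x + u (x : S) : ℝ) : S) = (F x : S) := by
      rw [← hφ, h, AddCircle.coe_add]
    obtain ⟨n, hn⟩ := AddSubgroup.mem_zmultiples_iff.mp (QuotientAddGroup.eq.mp h1)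
    refine ⟨n, ?_⟩
    simp only [zsmul_eq_mul, mul_one] at hn
    linarith
  have hconst : ∀ x y : ℝ, F x - (x + u (x : S)) = F y - (y + u (y : S)) := by
    choose n hn using hint
    have hnc : Continuous fun x => (n x : ℝ) := by
      simp only [hn]
      exact continuous_iff_continuousAt.mpr fun x => (hd x).continuousAt
    have hnc' : Continuous n := Int.isClosedEmbedding_coe_real.isInducing.continuous_iff.mpr hnc
    intro x y
    rw [← hn, ← hn, PreconnectedSpace.constant inferInstance hnc' (x := x) (y := y)]
  intro x
  induction x using QuotientAddGroup.induction_on with | H x => ?_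
  have h0 := (hd x).unique
    ((hasDerivAt_const x (F 0 - (0 + u ((0 : ℝ) : S)))).congr_of_eventuallyEq
      (Eventually.of_forall fun y => hconst y 0))
  rw [← sub_eq_zero.mp h0]
  exact hF' x

/-- The lift `x + u x` is strictly increasing, onto because `u` is bounded, and commutes with
integer translations; so it descends to a bijection of the circle. -/
theorem exists_D_of_mem {u : CS} (hu : u ∈ diffDomain) : ∃ φ : D, ∀ x, φ x = x + (u x : S) := by
  let F : ℝ → ℝ := fun x => x + u (x : S)
  have hd : ∀ x : ℝ, HasDerivAt F (1 + u.dx (x : S)) x := fun x =>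
    (hasDerivAt_id x).add (u.hasDerivAt x)
  have hF : ContDiff ℝ ∞ F := contDiff_id.add u.contDiff
  have hF' : ∀ x, 0 < deriv F x := fun x => by rw [(hd x).deriv]; exact hu x
  have hF1 : ∀ x, F (x + 1) = F x + 1 := fun x => by
    have : ((x + 1 : ℝ) : S) = (x : S) := by simp
    simp only [F, this]
    ring
  have hFn : ∀ (x : ℝ) (n : ℤ), F (x + n) = F x + n := fun x n => by
    have : ((x + n : ℝ) : S) = (x : S) := by
      simp
    simp only [F, this]
    ring
  have hmono : StrictMono F := strictMono_of_deriv_pos hF'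
  have hle : ∀ x : ℝ, |u (x : S)| ≤ ‖u.toC‖ := fun x => u.abs_apply_le_norm x
  have hsurj : Function.Surjective F := by
    refine hF.continuous.surjective ?_ ?_
    · refine tendsto_atTop_mono (f := fun x => x + -‖u.toC‖) (fun x => ?_)
        (tendsto_atTop_add_const_right _ _ tendsto_id)
      have := (abs_le.mp (hle x)).1
      simp only [F]
      linarith
    · refine tendsto_atBot_mono (f := fun x => x + ‖u.toC‖) (fun x => ?_)
        (tendsto_atBot_add_const_right _ _ tendsto_id)
      have := (abs_le.mp (hle x)).2
      simp only [F]
      linarith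
  have hcoe : ∀ x : ℝ, (x : S) + (u (x : S) : S) = (F x : S) := fun x => by
    rw [← AddCircle.coe_add]
  have hbij : Function.Bijective fun x : S => x + (u x : S) := by
    constructor
    · intro x y h
      induction x using QuotientAddGroup.induction_on with | H x => ?_
      induction y using QuotientAddGroup.induction_on with | H y => ?_
      have h1 : (F x : S) = (F y : S) := by rw [← hcoe, ← hcoe]; exact h
      obtain ⟨n, hn⟩ := AddSubgroup.mem_zmultiples_iff.mp (QuotientAddGroup.eq.mp h1)
      have h2 : F (x + n) = F y := by
        rw [hFn]
        simp only [zsmul_eq_mul, mul_one] at hn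
        linarith
      rw [← hmono.injective h2]
      change (x : S) = ((x + n : ℝ) : S)
      rw [show ((x + n : ℝ) : S) = (x : S) by simp]
    · intro y
      induction y using QuotientAddGroup.induction_on with | H y => ?_
      obtain ⟨x, hx⟩ := hsurj y
      exact ⟨(x : S), by change (x : S) + (u (x : S) : S) = (y : S); rw [hcoe, hx]⟩
  exact ⟨⟨Equiv.ofBijective _ hbij, F, hF, hF', hF1, fun x => hcoe x⟩, fun x => rfl⟩

theorem toD_apply {u : CS} (hu : u ∈ diffDomain) (x : S) : toD u x = x + (u x : S) := by
  obtain ⟨φ, hφ⟩ := exists_D_of_mem hu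
  rw [toD, D.translate_apply (ψ := φ) hφ, hφ]

theorem D.exists_eq_toD (φ : D) : ∃ u ∈ diffDomain, φ = toD u := by
  obtain ⟨u, hu⟩ := φ.exists_toFun_eq
  have hm := D.mem_diffDomain hu
  exact ⟨u, hm, D.ext fun x => by rw [hu, toD_apply hm]⟩

theorem toD_translate {u v : CS} (hu : u ∈ diffDomain) (huv : u + v ∈ diffDomain) :
    (toD u).translate v = toD (u + v) :=
  D.translate_apply fun x => by
    rw [toD_apply hu, toD_apply huv, add_assoc, ← AddCircle.coe_add, add_apply]

theorem toD_chartTarget {u : CS} (hu : u ∈ diffDomain) :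
    (toD u).chartTarget = {v | (∀ x, |v x| < 1 / 2) ∧ u + v ∈ diffDomain} := by
  ext v
  refine and_congr_right fun _ => ⟨?_, ?_⟩
  · rintro ⟨ψ, hψ⟩
    exact D.mem_diffDomain (φ := ψ) fun x => by
      rw [hψ, toD_apply hu, add_assoc, ← AddCircle.coe_add, add_apply]
  · intro h
    exact ⟨toD (u + v), fun x => by
      rw [toD_apply h, toD_apply hu, add_assoc, ← AddCircle.coe_add, add_apply]⟩

theorem D.isOpen_chartTarget (φ : D) : IsOpen φ.chartTarget := by
  obtain ⟨u, hu, rfl⟩ := φ.exists_eq_toD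
  rw [toD_chartTarget hu]
  refine IsOpen.inter ?_ (isOpen_diffDomain.preimage (continuous_const.add continuous_id))
  have h := isOpen_setOf_forall_mem (isOpen_Ioo (a := -(1 / 2 : ℝ)) (b := 1 / 2))
  simp only [Set.mem_Ioo, ← abs_lt] at h
  exact h

theorem D.zero_mem_chartTarget (φ : D) : (0 : CS) ∈ φ.chartTarget := by
  refine ⟨fun x => by simp, φ, fun x => by simp⟩

theorem D.translate_zero (φ : D) : φ.translate 0 = φ :=
  D.translate_apply fun x => by simp

theorem D.translate_translate {φ : D} {u v : CS} (hu : u ∈ φ.chartTarget)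
    (huv : u + v ∈ φ.chartTarget) : (φ.translate u).translate v = φ.translate (u + v) := by
  obtain ⟨w, hw, rfl⟩ := φ.exists_eq_toD
  rw [toD_chartTarget hw] at hu huv
  rw [toD_translate hw hu.2, toD_translate hw huv.2, toD_translate hu.2 (by
    rw [add_assoc]; exact huv.2), add_assoc]

theorem comp_toD {u : CS} (hu : u ∈ diffDomain) (v : CS) : v.comp (toD u) = v.shift u :=
  CS.ext fun x => congr_arg v.toFun (toD_apply hu x)

theorem comp_inv_comp (v : CS) (φ : D) : (v.comp φ.inv).comp φ = v :=
  CS.ext fun x => congr_arg v.toFun (φ.toEquiv.symm_apply_apply x)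

theorem comp_comp_inv (v : CS) (φ : D) : (v.comp φ).comp φ.inv = v :=
  CS.ext fun x => congr_arg v.toFun (φ.toEquiv.apply_symm_apply x)

/-! ### Inversion -/

/-- The function `J u` such that `Id + J u` is the inverse of `Id + u`. -/
def invCoord (u : CS) : CS := -u.comp (toD u).inv

theorem toD_inv_apply {u : CS} (hu : u ∈ diffDomain) (x : S) :
    (toD u).inv x = x + (invCoord u x : S) := by
  obtain ⟨y, rfl⟩ := (toD u).toEquiv.surjective x
  have h : (toD u).inv ((toD u) y) = y := (toD u).toEquiv.symm_apply_apply y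
  change (toD u).inv (toD u y) = toD u y + ((-u ((toD u).inv (toD u y)) : ℝ) : S)
  rw [h, toD_apply hu, AddCircle.coe_neg, add_neg_cancel_right]

theorem comp_toD_inv {u : CS} (hu : u ∈ diffDomain) (v : CS) :
    v.comp (toD u).inv = v.shift (invCoord u) :=
  CS.ext fun x => congr_arg v.toFun (toD_inv_apply hu x)

theorem shift_invCoord_self {u : CS} (hu : u ∈ diffDomain) : u.shift (invCoord u) = -invCoord u := by
  rw [← comp_toD_inv hu, invCoord, neg_neg]

/-- This is the derivative of an inverse function. It controls `(invCoord u).dx` by `invCoord u`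
itself and so raises the order of convergence by one. -/
theorem one_add_dx_invCoord {u : CS} (hu : u ∈ diffDomain) :
    (one + u.dx.shift (invCoord u)).mul (one + (invCoord u).dx) = one := by
  have h := congr_arg CS.dx (shift_invCoord_self hu)
  rw [dx_shift, dx_neg] at h
  refine CS.ext fun x => ?_
  have hx := congr_arg (fun w : CS => w x) h
  simp only [mul_apply, add_apply, neg_apply, one_apply] at hx ⊢
  linear_combination hx

/-- If `y = (Id + u)⁻¹ x` and `q = (u₀ - u) y`, then `(Id + u₀) y = x + q`, so `y = (Id + u₀)⁻¹ (x +
q)`. This exact comparison of two inverses replaces an inverse function theorem. -/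
theorem invCoord_eq {u u₀ : CS} (hu : u ∈ diffDomain) (hu₀ : u₀ ∈ diffDomain) :
    invCoord u = (u₀ - u).shift (invCoord u) +
      (invCoord u₀).shift ((u₀ - u).shift (invCoord u)) := by
  refine CS.ext fun x => ?_
  obtain ⟨y, rfl⟩ := (toD u).toEquiv.surjective x
  have h : (toD u).inv ((toD u) y) = y := (toD u).toEquiv.symm_apply_apply y
  have h₀ : (toD u₀).inv ((toD u₀) y) = y := (toD u₀).toEquiv.symm_apply_apply y
  have hJ : invCoord u (toD u y) = -u y := congr_arg (fun z => -u z) h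
  have hJ₀ : invCoord u₀ (toD u₀ y) = -u₀ y := congr_arg (fun z => -u₀ z) h₀
  have hq : (u₀ - u).shift (invCoord u) (toD u y) = u₀ y - u y := by
    rw [shift_apply, ← toD_inv_apply hu, h, sub_apply]
  have e : toD u y + ((u₀ y - u y : ℝ) : S) = toD u₀ y := by
    rw [toD_apply hu, toD_apply hu₀, add_assoc, ← AddCircle.coe_add, add_sub_cancel]
  rw [add_apply, shift_apply (invCoord u₀), hq, e, hJ, hJ₀]
  ring

/-- In `invCoord_eq` the displacement is bounded in sup norm by `u₀ - u`, whatever `invCoord u` is;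
this gives order zero. Reciprocals then give the derivatives through `one_add_dx_invCoord`. -/
theorem continuousOn_invCoord : ContinuousOn invCoord diffDomain := by
  intro u₀ hu₀
  have hid : ∀ n, TendstoC n (fun u : CS => u) (𝓝[diffDomain] u₀) u₀ :=
    tendsto_iff.mp (tendsto_id.mono_left nhdsWithin_le_nhds)
  have hmem : ∀ᶠ u in 𝓝[diffDomain] u₀, u ∈ diffDomain := self_mem_nhdsWithin
  refine tendsto_iff.mpr fun n => ?_
  have zero : TendstoC 0 invCoord (𝓝[diffDomain] u₀) (invCoord u₀) := by
    have hq : TendstoC 0 (fun u => (u₀ - u).shift (invCoord u)) (𝓝[diffDomain] u₀) 0 := by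
      have h0 := tendstoC_zero.mp ((tendstoC_const 0 u₀).sub (hid 0))
      rw [sub_self] at h0
      have h1 := h0.norm
      have hz : (0 : CS).toC = 0 := rfl
      rw [tendstoC_zero, hz]
      rw [hz, norm_zero] at h1
      refine squeeze_zero_norm (fun u => ?_) h1
      exact (ContinuousMap.norm_le _ (norm_nonneg _)).mpr fun x =>
        (u₀ - u).toC.norm_coe_le_norm _
    have h1 := hq.add ((tendstoC_const 0 (invCoord u₀)).shift hq)
    rw [shift_zero, zero_add] at h1
    intro i hi
    refine (h1 i hi).congr' ?_
    filter_upwards [hmem] with u hu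
    rw [← invCoord_eq hu hu₀]
  induction n with
  | zero => exact zero
  | succ n ih =>
    refine tendstoC_succ.mpr ⟨zero, ?_⟩
    have h1 : TendstoC n (fun u => one + u.dx.shift (invCoord u)) (𝓝[diffDomain] u₀)
        (one + u₀.dx.shift (invCoord u₀)) :=
      (tendstoC_const n one).add ((tendstoC_succ.mp (hid (n + 1))).2.shift ih)
    have h2 := h1.of_mul_eq_one (r := fun u => one + (invCoord u).dx)
      (by filter_upwards [hmem] with u hu using one_add_dx_invCoord hu) (one_add_dx_invCoord hu₀)
    simpa using h2.sub (tendstoC_const n one)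

/-- By `invCoord_eq`, `invCoord (u + h • v)` is the value of `q ↦ q + J.shift q` at `h` times a
direction that depends on `h` and tends to `-v.shift J`. The slope of that map at `0` along a
convergent direction is already known. -/
theorem hasDirDeriv_invCoord {u : CS} (hu : u ∈ diffDomain) (v : CS) :
    HasDirDeriv invCoord u v (-(v.shift (invCoord u)).mul (one + (invCoord u).dx)) := by
  set J := invCoord u
  have hmem : ∀ᶠ h : ℝ in 𝓝[≠] 0, u + h • v ∈ diffDomain :=
    (eventually_line_mem isOpen_diffDomain hu v).filter_mono nhdsWithin_le_nhds
  have hline : Tendsto (fun h : ℝ => u + h • v) (𝓝[≠] 0) (𝓝[diffDomain] u) := by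
    refine tendsto_nhdsWithin_iff.mpr ⟨?_, hmem⟩
    have hc : Continuous fun t : ℝ => u + t • v := by fun_prop
    simpa using (hc.tendsto 0).mono_left (nhdsWithin_le_nhds (s := {(0 : ℝ)}ᶜ))
  have hJ : Tendsto (fun h : ℝ => invCoord (u + h • v)) (𝓝[≠] 0) (𝓝 J) :=
    Tendsto.comp (g := invCoord) (continuousOn_invCoord u hu).tendsto hline
  have hw : Tendsto (fun h : ℝ => -v.shift (invCoord (u + h • v))) (𝓝[≠] 0) (𝓝 (-v.shift J)) :=
    ((continuous_shift.tendsto (v, J)).comp (tendsto_const_nhds.prodMk_nhds hJ)).neg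
  have hid : ∀ w : CS, HasDirDeriv (fun q : CS => q) 0 w w := fun w => by
    refine tendsto_const_nhds.congr' ?_
    filter_upwards [self_mem_nhdsWithin] with h hh
    rw [zero_add, sub_zero, inv_smul_smul₀ hh]
  have hf : CnOn 1 (fun q : CS => q + J.shift q) Set.univ :=
    (CnOn.clm 1 (ContinuousLinearMap.id ℝ CS) _).add
      (cnOn_shift (CnOn.const 1 J _) (CnOn.clm 1 (ContinuousLinearMap.id ℝ CS) _))
  have hf0 : HasDirDeriv (fun q : CS => q + J.shift q) 0 (-v.shift J)
      (-v.shift J + (J.dx.shift 0).mul (-v.shift J)) :=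
    (hid _).add (hasDirDeriv_shift_right J 0 _)
  obtain ⟨_, f', f1, f2⟩ := hf
  have hlim := tendsto_slope_of_continuousOn isOpen_univ f1 f2 (x := 0) trivial
    (tendsto_const_nhds (x := (0 : CS))) hw
  rw [(f1 0 trivial _).unique hf0] at hlim
  have e : -v.shift J + (J.dx.shift 0).mul (-v.shift J) = -(v.shift J).mul (one + J.dx) := by
    rw [shift_zero]
    refine CS.ext fun x => ?_
    simp only [add_apply, neg_apply, mul_apply, one_apply]
    ring
  rw [e] at hlim
  refine hlim.congr' ?_
  filter_upwards [hmem] with h hh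
  have hq : (u - (u + h • v)).shift (invCoord (u + h • v)) =
      h • -v.shift (invCoord (u + h • v)) := by
    rw [sub_add_cancel_left, smul_neg, ← smul_shift]
    rfl
  rw [zero_add, zero_add, shift_zero, ← hq, ← invCoord_eq hh hu]

theorem cnOn_invCoord (n : ℕ) : CnOn n invCoord diffDomain := by
  induction n with
  | zero => exact continuousOn_invCoord
  | succ n ih =>
    let fst : CS × CS →L[ℝ] CS := ContinuousLinearMap.fst ℝ CS CS
    let snd : CS × CS →L[ℝ] CS := ContinuousLinearMap.snd ℝ CS CS
    have h1 : CnOn n (fun p : CS × CS => invCoord p.1) (diffDomain ×ˢ Set.univ) :=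
      ih.comp_linear fst fun p hp => hp.1
    refine ⟨continuousOn_invCoord,
      fun p => -(p.2.shift (invCoord p.1)).mul (one + (invCoord p.1).dx),
      fun u hu v => hasDirDeriv_invCoord hu v, CnOn.neg (cnOn_mul ?_ ?_)⟩
    · exact cnOn_shift (CnOn.clm n snd _) h1
    · exact (CnOn.const n one _).add (h1.clm_comp dxL)

/-! ## The inertia operator `A_k` -/

instance : IsProbabilityMeasure (volume : Measure S) := ⟨UnitAddCircle.measure_univ⟩

namespace CS

/-! ### Integration by parts and a Sobolev inequality on the circle. -/

theorem integrable (u : CS) : Integrable (fun x : S => u x) :=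
  u.continuous.integrable_of_hasCompactSupport (HasCompactSupport.of_compactSpace _)

/-- Integration over the circle. -/
def integral : CS →L[ℝ] ℝ where
  toFun u := ∫ x : S, u x
  map_add' u v := integral_add u.integrable v.integrable
  map_smul' c u := integral_const_mul c _
  cont := by
    let l : C(S, ℝ) →ₗ[ℝ] ℝ :=
      { toFun := fun f => ∫ x : S, f x
        map_add' := fun f g => integral_add
          (f.continuous.integrable_of_hasCompactSupport (HasCompactSupport.of_compactSpace _))
          (g.continuous.integrable_of_hasCompactSupport (HasCompactSupport.of_compactSpace _))
        map_smul' := fun c f => integral_const_mul c _ }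
    have hl : ∀ f, ‖l f‖ ≤ 1 * ‖f‖ := fun f => by
      have := norm_integral_le_of_norm_le_const (μ := (volume : Measure S))
        (Eventually.of_forall fun x => f.norm_coe_le_norm x)
      rw [probReal_univ, mul_one] at this
      rwa [one_mul]
    exact (l.mkContinuous 1 hl).continuous.comp continuous_toC

theorem integral_apply (u : CS) : integral u = ∫ x : S, u x := rfl

theorem integral_eq_interval (u : CS) (b : ℝ) : integral u = ∫ x in b..b + 1, u (x : S) :=
  (UnitAddCircle.intervalIntegral_preimage b u.toFun).symm

theorem integral_nonneg {u : CS} (h : ∀ x, 0 ≤ u x) : 0 ≤ integral u :=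
  MeasureTheory.integral_nonneg h

theorem integral_dx (u : CS) : integral u.dx = 0 := by
  rw [integral_eq_interval _ 0, intervalIntegral.integral_eq_sub_of_hasDerivAt
    (fun x _ => u.hasDerivAt x)
    (u.dx.contDiff.continuous.intervalIntegrable _ _), zero_add,
    show ((1 : ℝ) : S) = ((0 : ℝ) : S) from AddCircle.coe_period 1, sub_self]

theorem integral_dx_mul (u v : CS) : integral (u.dx.mul v) = -integral (u.mul v.dx) := by
  have := integral_dx (u.mul v)
  rw [dx_mul, map_add] at this
  linarith

theorem integral_mul_iterate_dx (u v : CS) (i : ℕ) :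
    integral (u.mul (dx^[i] v)) = (-1) ^ i * integral ((dx^[i] u).mul v) := by
  induction i generalizing u with
  | zero => simp
  | succ i ih =>
    rw [Function.iterate_succ_apply', Function.iterate_succ_apply, ← neg_neg (integral (u.mul _)),
      ← integral_dx_mul, ih]
    ring

theorem integral_sq_le_norm_sq (u : CS) : integral (u.mul u) ≤ ‖u.toC‖ ^ 2 := by
  have h := integral_mono (μ := (volume : Measure S)) (u.mul u).integrable
    (integrable_const (‖u.toC‖ ^ 2)) (fun x => by
      change u x * u x ≤ _
      rw [← sq, ← sq_abs]
      exact pow_le_pow_left₀ (abs_nonneg _) (u.abs_apply_le_norm x) 2)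
  rwa [integral_const, probReal_univ, one_smul] at h

/-- A Sobolev inequality. -/
theorem norm_sq_le_integral (u : CS) :
    ‖u.toC‖ ^ 2 ≤ 2 * integral (u.mul u) + integral (u.dx.mul u.dx) := by
  have hnn : ∀ v : CS, 0 ≤ integral (v.mul v) := fun v =>
    integral_nonneg fun x => mul_self_nonneg _
  have key : ∀ x, u x ^ 2 ≤ 2 * integral (u.mul u) + integral (u.dx.mul u.dx) := by
    intro x
    -- Start from a point where `u²` is at most its mean and integrate `2 u u' ≤ u² + u'²` from
    -- there. The coefficient `2` collects the mean and the `u²` of this bound.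
    obtain ⟨y, hy⟩ := exists_le_integral (μ := (volume : Measure S)) (u.mul u).integrable
    induction y using QuotientAddGroup.induction_on with | H b => ?_
    have hx : x ∈ ((↑) : ℝ → S) '' Set.Ico b (b + 1) := by
      rw [AddCircle.coe_image_Ico_eq]; trivial
    obtain ⟨a, ⟨hba, hab⟩, rfl⟩ := hx
    let w : CS := u.mul u + u.dx.mul u.dx
    have h1 : ∫ t in b..a, (u.mul u).dx (t : S) = (u.mul u) (a : S) - (u.mul u) (b : S) :=
      intervalIntegral.integral_eq_sub_of_hasDerivAt (fun t _ => (u.mul u).hasDerivAt t)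
        ((u.mul u).dx.contDiff.continuous.intervalIntegrable _ _)
    have h2 : ∫ t in b..a, (u.mul u).dx (t : S) ≤ ∫ t in b..a, w (t : S) := by
      refine intervalIntegral.integral_mono_on hba
        ((u.mul u).dx.contDiff.continuous.intervalIntegrable _ _)
        (w.contDiff.continuous.intervalIntegrable _ _) fun t _ => ?_
      simp only [w, dx_mul, add_apply, mul_apply]
      nlinarith [sq_nonneg (u (t : S) - u.dx (t : S))]
    have h3 : ∫ t in b..a, w (t : S) ≤ ∫ t in b..b + 1, w (t : S) := by
      refine intervalIntegral.integral_mono_interval le_rfl hba hab.le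
        (Eventually.of_forall fun t => ?_) (w.contDiff.continuous.intervalIntegrable _ _)
      exact add_nonneg (mul_self_nonneg _) (mul_self_nonneg _)
    rw [← integral_eq_interval, map_add] at h3
    rw [← integral_apply] at hy
    simp only [mul_apply] at h1 hy
    rw [sq]
    linarith
  have hr : 0 ≤ 2 * integral (u.mul u) + integral (u.dx.mul u.dx) := by
    linarith [hnn u, hnn u.dx]
  have hn : ‖u.toC‖ ≤ √(2 * integral (u.mul u) + integral (u.dx.mul u.dx)) := by
    rw [ContinuousMap.norm_le _ (Real.sqrt_nonneg _)]
    intro x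
    exact Real.abs_le_sqrt (key x)
  exact (Real.le_sqrt (norm_nonneg _) hr).mp hn

end CS

open CS

/-- `A_k` as a continuous linear map. -/
def AL (k : ℕ) : CS →L[ℝ] CS := ∑ i ∈ Finset.range (k + 1), (-1 : ℝ) ^ i • dxL ^ (2 * i)

theorem coe_AL (k : ℕ) : ⇑(AL k) = A k := by
  funext u
  simp only [AL, A, _root_.sum_apply, _root_.smul_apply,
    FunLike.coe_pow_eq_iterate]
  rfl

theorem A_dx (k : ℕ) (u : CS) : A k u.dx = (A k u).dx := by
  rw [← dxL_apply (A k u), A, A, map_sum]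
  refine Finset.sum_congr rfl fun i _ => ?_
  rw [map_smul, dxL_apply]
  exact congr_arg _ ((Function.iterate_succ_apply dx _ u).symm.trans
    (Function.iterate_succ_apply' dx _ u))

theorem A_iterate_dx (k i : ℕ) (u : CS) : A k (dx^[i] u) = dx^[i] (A k u) := by
  induction i with
  | zero => rfl
  | succ i ih => rw [Function.iterate_succ_apply', Function.iterate_succ_apply', A_dx, ih]

/-! ### Positivity and a priori estimates for `A_k`. -/

theorem innerH_eq_sum (k : ℕ) (u v : CS) :
    innerH k u v = ∑ i ∈ Finset.range (k + 1), CS.integral ((dx^[i] u).mul (dx^[i] v)) := rfl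

theorem innerH_eq (k : ℕ) (u v : CS) : innerH k u v = CS.integral ((A k u).mul v) := by
  rw [← mulₗ_apply, A, map_sum, LinearMap.sum_apply, map_sum, innerH_eq_sum]
  refine Finset.sum_congr rfl fun i _ => ?_
  rw [integral_mul_iterate_dx, ← Function.iterate_add_apply, ← two_mul, map_smul,
    LinearMap.smul_apply, map_smul]
  rfl

theorem innerH_comm (k : ℕ) (u v : CS) : innerH k u v = innerH k v u := by
  simp only [innerH_eq_sum, CS.mul_comm]

theorem integral_sq_le_innerH (k : ℕ) (u : CS) : CS.integral (u.mul u) ≤ innerH k u u := by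
  rw [innerH_eq_sum]
  exact Finset.single_le_sum (f := fun i => CS.integral ((dx^[i] u).mul (dx^[i] u)))
    (fun i _ => CS.integral_nonneg fun x => mul_self_nonneg _)
    (Finset.mem_range.mpr k.succ_pos)

/-- Expand `0 ≤ ∫ (A u - u)²` and use `∫ u² ≤ ∫ (A u) u`. -/
theorem integral_sq_le_integral_A_sq (k : ℕ) (u : CS) :
    CS.integral (u.mul u) ≤ CS.integral ((A k u).mul (A k u)) := by
  have h1 := integral_sq_le_innerH k u
  rw [innerH_eq] at h1
  have h2 : 0 ≤ CS.integral ((A k u - u).mul (A k u - u)) :=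
    CS.integral_nonneg fun x => mul_self_nonneg _
  have e : (A k u - u).mul (A k u - u) =
      (A k u).mul (A k u) - (2 : ℝ) • (A k u).mul u + u.mul u :=
    CS.ext fun x => by simp only [mul_apply, add_apply, sub_apply, smul_apply]; ring
  rw [e, map_add, map_sub, map_smul, smul_eq_mul] at h2
  linarith

/-- `A k` commutes with `dx`, so the `L²` bound also holds for `u.dx`, and the Sobolev inequality
applies. The estimate yields injectivity and, applied to derivatives of `u`, continuity of the
inverse. -/
theorem norm_sq_le_A (k : ℕ) (u : CS) :
    ‖u.toC‖ ^ 2 ≤ 2 * ‖(A k u).toC‖ ^ 2 + ‖(A k u).dx.toC‖ ^ 2 := by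
  have h1 := u.norm_sq_le_integral
  have h2 := integral_sq_le_integral_A_sq k u
  have h3 := integral_sq_le_integral_A_sq k u.dx
  rw [A_dx] at h3
  have h4 := (A k u).integral_sq_le_norm_sq
  have h5 := (A k u).dx.integral_sq_le_norm_sq
  linarith

theorem eq_zero_of_norm_toC {u : CS} (h : ‖u.toC‖ = 0) : u = 0 :=
  CS.ext fun x => DFunLike.congr_fun (norm_eq_zero.mp h) x

theorem eq_zero_of_innerH_self {k : ℕ} {u : CS} (h : innerH k u u = 0) : u = 0 := by
  have h1 := integral_sq_le_innerH k u
  rw [h] at h1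
  have h2 : Continuous fun x : S => u x * u x := u.continuous.mul u.continuous
  have h3 : (fun x : S => u x * u x) = 0 := by
    rw [← h2.ae_eq_iff_eq volume continuous_zero,
      ← integral_eq_zero_iff_of_nonneg (fun x => mul_self_nonneg _) (u.mul u).integrable]
    exact le_antisymm h1 (MeasureTheory.integral_nonneg fun x => mul_self_nonneg _)
  exact CS.ext fun x => mul_self_eq_zero.mp (congr_fun h3 x)

theorem A_injective (k : ℕ) : Function.Injective (A k) := by
  rw [← coe_AL]
  refine (injective_iff_map_eq_zero (AL k)).mpr fun u hu => eq_zero_of_norm_toC ?_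
  rw [coe_AL] at hu
  have h := norm_sq_le_A k u
  have h0 : (0 : CS).toC = 0 := rfl
  rw [hu, ← dxL_apply, map_zero, h0, norm_zero] at h
  nlinarith [norm_nonneg u.toC]

/-! ### Constant coefficient operators on smooth periodic complex functions -/

/-- The smooth complex functions on `ℝ` of period `1`. -/
def periodicSubmodule : Submodule ℂ (ℝ → ℂ) where
  carrier := {f | ContDiff ℝ ∞ f ∧ Function.Periodic f 1}
  add_mem' hf hg := ⟨hf.1.add hg.1, hf.2.add hg.2⟩
  zero_mem' := ⟨contDiff_const, fun _ => rfl⟩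
  smul_mem' c _ hf := ⟨contDiff_const.smul hf.1, hf.2.smul c⟩

namespace periodicSubmodule

theorem hasDerivAt (f : periodicSubmodule) (x : ℝ) : HasDerivAt f.1 (deriv f.1 x) x :=
  (f.2.1.differentiable (by simp) x).hasDerivAt

/-- The derivative of a smooth periodic function. -/
def D : Module.End ℂ periodicSubmodule where
  toFun f := ⟨deriv f.1, (contDiff_infty_iff_deriv.mp f.2.1).2, fun x => by
    rw [← deriv_comp_add_const, funext f.2.2]⟩
  map_add' f g := Subtype.ext <| funext fun x => ((hasDerivAt f x).add (hasDerivAt g x)).deriv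
  map_smul' c f := Subtype.ext <| funext fun x => ((hasDerivAt f x).const_smul c).deriv

theorem D_sub_surjective {μ : ℂ} (hμ : Complex.exp μ ≠ 1) :
    Function.Surjective (D - algebraMap ℂ (Module.End ℂ periodicSubmodule) μ) := by
  intro f
  let h : ℝ → ℂ := fun s => Complex.exp (-(μ * s)) * f.1 s
  have hE : ∀ ν : ℂ, ContDiff ℝ ∞ fun s : ℝ => Complex.exp (ν * s) := fun ν =>
    (contDiff_const.mul Complex.ofRealCLM.contDiff).cexp
  have hh : ContDiff ℝ ∞ h := by
    have := (hE (-μ)).mul f.2.1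
    simpa only [neg_mul] using this
  let I : ℝ → ℂ := fun x => ∫ s in (0 : ℝ)..x, h s
  have hI : ∀ x, HasDerivAt I (h x) x := fun x =>
    hh.continuous.integral_hasStrictDerivAt 0 x |>.hasDerivAt
  have hIsm : ContDiff ℝ ∞ I := contDiff_infty_iff_deriv.mpr
    ⟨fun x => (hI x).differentiableAt, by rwa [funext fun x => (hI x).deriv]⟩
  -- Variation of constants gives `u = exp(μ x) (c + I x)`; periodicity forces `exp μ (c + I 1) =
  -- c`, which is solvable since `exp μ ≠ 1`.
  let c : ℂ := Complex.exp μ * I 1 / (1 - Complex.exp μ)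
  have hc : Complex.exp μ * (c + I 1) = c := by
    have : (1 : ℂ) - Complex.exp μ ≠ 0 := sub_ne_zero.mpr hμ.symm
    simp only [c]
    field_simp
    ring
  have hIper : ∀ x, I (x + 1) = I 1 + Complex.exp (-μ) * I x := by
    intro x
    have hint : ∀ a b : ℝ, IntervalIntegrable h volume a b := fun a b =>
      hh.continuous.intervalIntegrable a b
    have h1 : I (x + 1) = I 1 + ∫ s in (0 + 1 : ℝ)..x + 1, h s := by
      rw [zero_add]
      exact (intervalIntegral.integral_add_adjacent_intervals (hint _ _) (hint _ _)).symm
    have h2 : ∫ s in (0 + 1 : ℝ)..x + 1, h s = Complex.exp (-μ) * I x := by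
      rw [← intervalIntegral.integral_comp_add_right]
      simp only [I]
      rw [← intervalIntegral.integral_const_mul]
      refine intervalIntegral.integral_congr fun s _ => ?_
      change Complex.exp (-(μ * ((s + 1 : ℝ) : ℂ))) * f.1 (s + 1) =
        Complex.exp (-μ) * (Complex.exp (-(μ * s)) * f.1 s)
      rw [f.2.2 s, ← mul_assoc, ← Complex.exp_add]
      push_cast
      ring_nf
    rw [h1, h2]
  let u : ℝ → ℂ := fun x => Complex.exp (μ * x) * (c + I x)
  have hu : ∀ x, HasDerivAt u (μ * u x + f.1 x) x := by
    intro x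
    have hlin : HasDerivAt (fun x : ℝ => μ * (x : ℂ)) μ x := by
      simpa using (Complex.ofRealCLM.hasDerivAt (x := x)).const_mul μ
    have h1 := hlin.cexp.mul ((hI x).const_add c)
    refine h1.congr_deriv ?_
    have : Complex.exp (μ * x) * Complex.exp (-(μ * x)) = 1 := by
      rw [← Complex.exp_add, add_neg_cancel, Complex.exp_zero]
    change Complex.exp (μ * x) * μ * (c + I x) +
      Complex.exp (μ * x) * (Complex.exp (-(μ * x)) * f.1 x) =
        μ * (Complex.exp (μ * x) * (c + I x)) + f.1 x
    linear_combination f.1 x * this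
  have husm : ContDiff ℝ ∞ u := (hE μ).mul (contDiff_const.add hIsm)
  have huper : Function.Periodic u 1 := by
    intro x
    have h1 : Complex.exp (μ * ((x + 1 : ℝ) : ℂ)) = Complex.exp (μ * x) * Complex.exp μ := by
      rw [← Complex.exp_add]; push_cast; ring_nf
    have h2 : Complex.exp μ * Complex.exp (-μ) = 1 := by
      rw [← Complex.exp_add, add_neg_cancel, Complex.exp_zero]
    simp only [u]
    rw [h1, hIper]
    linear_combination Complex.exp (μ * x) * hc + Complex.exp (μ * x) * I x * h2
  refine ⟨⟨u, husm, huper⟩, Subtype.ext (funext fun x => ?_)⟩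
  change deriv u x - μ • u x = f.1 x
  rw [(hu x).deriv, smul_eq_mul, add_sub_cancel_left]

-- Over `ℂ` the operator is a nonzero scalar times a product of factors `D - μ`, each onto by
-- `D_sub_surjective`.
open Polynomial in
theorem aeval_D_surjective {p : ℂ[X]} (hp : p ≠ 0) (hroots : ∀ μ, p.IsRoot μ → Complex.exp μ ≠ 1) :
    Function.Surjective (aeval D p) := by
  have key : ∀ s : Multiset ℂ, (∀ μ ∈ s, Complex.exp μ ≠ 1) →
      Function.Surjective (aeval D (s.map fun μ => X - C μ).prod) := by
    intro s
    induction s using Multiset.induction_on with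
    | empty =>
      intro _
      rw [Multiset.map_zero, Multiset.prod_zero, map_one]
      exact Function.surjective_id
    | cons μ s ih =>
      intro hs
      rw [Multiset.map_cons, Multiset.prod_cons, map_mul, map_sub, aeval_X, aeval_C]
      exact (D_sub_surjective (hs μ (Multiset.mem_cons_self μ s))).comp
        (ih fun ν hν => hs ν (Multiset.mem_cons_of_mem hν))
  rw [(IsAlgClosed.splits p).eq_prod_roots, map_mul, aeval_C]
  refine Function.Surjective.comp (g := ⇑(algebraMap ℂ (Module.End ℂ periodicSubmodule) _)) ?_
    (key _ fun μ hμ => hroots μ (isRoot_of_mem_roots hμ))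
  intro f
  refine ⟨p.leadingCoeff⁻¹ • f, ?_⟩
  rw [Module.algebraMap_end_apply, smul_inv_smul₀ (leadingCoeff_ne_zero.mpr hp)]

/-- The real part of a smooth periodic function. -/
def re : periodicSubmodule →+ CS where
  toFun f := CS.of (f.2.2.comp Complex.re).lift (Complex.reCLM.contDiff.comp f.2.1)
  map_zero' := CS.ext fun x => by
    induction x using QuotientAddGroup.induction_on with | H x => rfl
  map_add' f g := CS.ext fun x => by
    induction x using QuotientAddGroup.induction_on with | H x => rfl

theorem re_smul (r : ℝ) (f : periodicSubmodule) : re ((r : ℂ) • f) = r • re f :=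
  CS.ext fun x => by
    induction x using QuotientAddGroup.induction_on with | H x => ?_
    exact Complex.re_ofReal_mul r (f.1 x)

theorem re_D (f : periodicSubmodule) : re (D f) = (re f).dx :=
  CS.ext fun x => by
    induction x using QuotientAddGroup.induction_on with | H x => ?_
    exact (CS.dx_apply_eq (u := re f)
      (Complex.reCLM.hasFDerivAt.comp_hasDerivAt x (hasDerivAt f x))).symm

theorem re_D_pow (f : periodicSubmodule) (n : ℕ) : re ((D ^ n) f) = CS.dx^[n] (re f) := by
  induction n with
  | zero => rfl
  | succ n ih => rw [pow_succ', Module.End.mul_apply, re_D, ih, Function.iterate_succ_apply']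

end periodicSubmodule

-- The equation is solved in complex functions; as `A k` has real coefficients, the real part of the
-- solution solves it too.
open periodicSubmodule Polynomial in
theorem A_surjective (k : ℕ) : Function.Surjective (A k) := by
  intro f
  let F : periodicSubmodule := ⟨fun x => ((f (x : S) : ℝ) : ℂ),
    Complex.ofRealCLM.contDiff.comp f.contDiff, fun x => by simp⟩
  let p : ℂ[X] := ∑ i ∈ Finset.range (k + 1), C ((((-1) ^ i : ℝ) : ℂ)) * X ^ (2 * i)
  -- At the frequencies `μ = 2πin` the alternating signs cancel those of `μ^(2i)`: the value is the
  -- sum of `(2πn)^(2i)`, whose term `i = 0` is `1`.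
  have heval : ∀ μ : ℂ, Complex.exp μ = 1 → p.eval μ ≠ 0 := by
    intro μ hμ
    obtain ⟨n, rfl⟩ := Complex.exp_eq_one_iff.mp hμ
    have h1 : p.eval (n * (2 * Real.pi * Complex.I)) =
        ((∑ i ∈ Finset.range (k + 1), ((n * (2 * Real.pi)) ^ 2) ^ i : ℝ) : ℂ) := by
      simp only [p, eval_finsetSum, eval_mul, eval_C, eval_pow, eval_X]
      push_cast
      refine Finset.sum_congr rfl fun i _ => ?_
      rw [pow_mul, ← mul_pow]
      congr 1
      linear_combination (-(n * (2 * Real.pi)) ^ 2 : ℂ) * Complex.I_sq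
    rw [h1, Complex.ofReal_ne_zero, Finset.sum_range_succ']
    have : 0 ≤ ∑ i ∈ Finset.range k, (((n : ℝ) * (2 * Real.pi)) ^ 2) ^ (i + 1) :=
      Finset.sum_nonneg fun i _ => by positivity
    rw [pow_zero]
    positivity
  have hp : p ≠ 0 := fun h => heval 0 Complex.exp_zero (by rw [h, eval_zero])
  obtain ⟨g, hg⟩ := aeval_D_surjective hp (fun μ hμ h => heval μ h hμ) F
  refine ⟨re g, ?_⟩
  have h1 : re F = f := CS.ext fun x => by
    induction x using QuotientAddGroup.induction_on with | H x => rfl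
  rw [← h1, ← hg]
  simp only [p, map_sum, LinearMap.sum_apply, map_mul, aeval_C, map_pow, aeval_X, A,
    Module.End.mul_apply, Module.algebraMap_end_apply]
  refine Finset.sum_congr rfl fun i _ => ?_
  rw [re_smul, re_D_pow]

/-! ### The inverse of `A_k` and the operator `B_k` -/

theorem A_bijective (k : ℕ) : Function.Bijective (A k) := ⟨A_injective k, A_surjective k⟩

/-- The inverse of `A_k` as a linear map. -/
def Ainvₗ (k : ℕ) : CS →ₗ[ℝ] CS :=
  (LinearEquiv.ofBijective (AL k).toLinearMap (by
    rw [ContinuousLinearMap.coe_coe, coe_AL]; exact A_bijective k)).symm.toLinearMap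

theorem A_Ainvₗ (k : ℕ) (u : CS) : A k (Ainvₗ k u) = u := by
  rw [← coe_AL]
  exact LinearEquiv.apply_symm_apply (LinearEquiv.ofBijective (AL k).toLinearMap _) u

/-- Bounding `i` derivatives of `u` by `i + 1` derivatives of `A k u` is far from elliptic
regularity, but suffices in the Fréchet topology. -/
theorem norm_iterate_dx_le_A (k i : ℕ) (u : CS) :
    ‖(CS.dx^[i] u).toC‖ ≤ 2 * (‖(CS.dx^[i] (A k u)).toC‖ + ‖(CS.dx^[i + 1] (A k u)).toC‖) := by
  have h := norm_sq_le_A k (CS.dx^[i] u)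
  rw [A_iterate_dx, ← Function.iterate_succ_apply' CS.dx] at h
  have h1 := norm_nonneg (CS.dx^[i] (A k u)).toC
  have h2 := norm_nonneg (CS.dx^[i + 1] (A k u)).toC
  refine le_of_sq_le_sq (h.trans ?_) (by positivity)
  nlinarith [mul_nonneg h1 h2]

/-- The inverse of `A_k` as a continuous linear map. -/
def Ainv (k : ℕ) : CS →L[ℝ] CS where
  toLinearMap := Ainvₗ k
  cont := by
    refine continuous_of_continuousAt_zero (Ainvₗ k) ?_
    refine CS.tendsto_iff.mpr fun _ i _ => ?_
    have hid : ∀ j, Tendsto (fun u : CS => CS.jets u j) (𝓝 0) (𝓝 0) := fun j => by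
      simpa using CS.tendsto_iff.mp (tendsto_id (α := CS) (x := 𝓝 0)) j j le_rfl
    rw [map_zero, map_zero, Pi.zero_apply]
    have hb := (((hid i).norm.add (hid (i + 1)).norm).const_mul 2)
    rw [norm_zero, add_zero, mul_zero] at hb
    refine squeeze_zero_norm (fun u => ?_) hb
    have h := norm_iterate_dx_le_A k i (Ainvₗ k u)
    rw [A_Ainvₗ] at h
    exact h

theorem A_Ainv (k : ℕ) (u : CS) : A k (Ainv k u) = u := A_Ainvₗ k u

theorem B_eq (k : ℕ) (u v : CS) :
    B k u v = -Ainv k ((2 : ℝ) • v.dx.mul (A k u) + v.mul (A k u.dx)) := by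
  rw [B]
  congr 1
  apply A_injective k
  rw [A_Ainv, Function.invFun_eq (A_surjective k _)]

/-- `B_k` as a bilinear map. -/
def Bₗ (k : ℕ) : CS →ₗ[ℝ] CS →ₗ[ℝ] CS :=
  -(((2 : ℝ) • (CS.mulₗ.compl₁₂ CS.dxₗ (AL k).toLinearMap).flip +
    (CS.mulₗ.compl₁₂ LinearMap.id ((AL k).toLinearMap ∘ₗ CS.dxₗ)).flip).compr₂
      (Ainv k).toLinearMap)

theorem Bₗ_apply (k : ℕ) (u v : CS) : Bₗ k u v = B k u v := by
  rw [B_eq, ← coe_AL]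
  rfl

/-- The inner product `⟨·, ·⟩_k` as a bilinear map. -/
def innerHₗ (k : ℕ) : CS →ₗ[ℝ] CS →ₗ[ℝ] ℝ :=
  (CS.mulₗ.comp (AL k).toLinearMap).compr₂ CS.integral.toLinearMap

theorem innerHₗ_apply (k : ℕ) (u v : CS) : innerHₗ k u v = innerH k u v := by
  rw [innerH_eq, ← coe_AL]
  rfl

theorem continuous_innerHₗ (k : ℕ) : Continuous fun p : CS × CS => innerHₗ k p.1 p.2 :=
  CS.integral.continuous.comp (CS.continuous_mul.comp
    (((AL k).continuous.comp continuous_fst).prodMk continuous_snd))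

/-- `B_k(·, v)` is the adjoint of the bracket with `v`. -/
theorem innerH_B (k : ℕ) (u v z : CS) :
    innerH k (B k u v) z = innerH k u (v.mul z.dx - v.dx.mul z) := by
  -- With `m = A k u`, moving the derivative off `m` in `-(2 v_x m + v m_x) z` leaves `m` times `-2
  -- v_x z + (v z)_x = v z_x - v_x z`.
  have h := CS.integral_dx_mul (A k u) (v.mul z)
  rw [innerH_eq, innerH_eq, B_eq, ← coe_AL, map_neg, coe_AL, A_Ainv, A_dx]
  have e1 : (-((2 : ℝ) • v.dx.mul (A k u) + v.mul (A k u).dx)).mul z =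
      -((2 : ℝ) • (A k u).mul (v.dx.mul z) + (A k u).dx.mul (v.mul z)) :=
    CS.ext fun x => by simp; ring
  have e2 : (A k u).mul (v.mul z.dx - v.dx.mul z) =
      (A k u).mul (v.mul z).dx - (2 : ℝ) • (A k u).mul (v.dx.mul z) :=
    CS.ext fun x => by simp [CS.dx_mul]; ring
  rw [e1, e2, map_neg, map_add, map_sub, h]
  ring

/-- The Christoffel operator of the right-invariant `H^k` metric at the identity. -/
def christoffel (k : ℕ) : CS →ₗ[ℝ] CS →ₗ[ℝ] CS :=
  (1 / 2 : ℝ) • (CS.mulₗ.compr₂ CS.dxₗ + Bₗ k + (Bₗ k).flip)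

theorem christoffel_apply (k : ℕ) (u v : CS) :
    christoffel k u v = (1 / 2 : ℝ) • ((u.mul v).dx + B k u v + B k v u) := by
  rw [← Bₗ_apply, ← Bₗ_apply]
  rfl

theorem christoffel_comm (k : ℕ) (u v : CS) : christoffel k u v = christoffel k v u := by
  rw [christoffel_apply, christoffel_apply, CS.mul_comm u v, add_right_comm]

theorem cnOn_christoffel (k : ℕ) {n : ℕ} {f g : CS → CS} {U : Set CS} (hf : CnOn n f U)
    (hg : CnOn n g U) : CnOn n (fun x => christoffel k (f x) (g x)) U := by
  have hB : ∀ {f g : CS → CS}, CnOn n f U → CnOn n g U → CnOn n (fun x => B k (f x) (g x)) U := by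
    intro f g hf hg
    simp only [B_eq, ← coe_AL]
    have h1 := (CS.cnOn_mul (hg.clm_comp CS.dxL) (hf.clm_comp (AL k))).clm_comp
      ((2 : ℝ) • ContinuousLinearMap.id ℝ CS)
    have h2 := CS.cnOn_mul hg ((hf.clm_comp CS.dxL).clm_comp (AL k))
    exact ((h1.add h2).clm_comp (Ainv k)).neg
  simp only [christoffel_apply]
  exact ((((CS.cnOn_mul hf hg).clm_comp CS.dxL).add (hB hf hg)).add (hB hg hf)).clm_comp
    ((1 / 2 : ℝ) • ContinuousLinearMap.id ℝ CS)

/-- This is compatibility with the metric read at the identity: the right side is what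
differentiating `Y ∘ ψ⁻¹` and `Z ∘ ψ⁻¹` produces besides `D_X Y` and `D_X Z`. -/
theorem innerH_christoffel (k : ℕ) (u y z : CS) :
    innerH k (christoffel k u y) z + innerH k y (christoffel k u z) =
      innerH k (y.dx.mul u) z + innerH k y (z.dx.mul u) := by
  -- Koszul's formula, the `B` terms being replaced by their adjoints. On adding the version with
  -- `y` and `z` exchanged, four terms cancel and the others double.
  have key : ∀ y z : CS, innerH k (christoffel k u y) z = (1 / 2 : ℝ) *
      (innerH k (y.dx.mul u) z + innerH k (u.dx.mul y) z +
        innerH k u (y.mul z.dx) - innerH k u (y.dx.mul z) +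
        innerH k y (z.dx.mul u) - innerH k y (u.dx.mul z)) := by
    intro y z
    rw [christoffel_apply, ← innerHₗ_apply, map_smul, map_add, map_add, CS.dx_mul, map_add,
      LinearMap.smul_apply, LinearMap.add_apply, LinearMap.add_apply, LinearMap.add_apply]
    simp only [innerHₗ_apply, innerH_B]
    simp only [← innerHₗ_apply, map_sub, CS.mul_comm u, smul_eq_mul]
    ring
  rw [innerH_comm k y (christoffel k u z), key, key, innerH_comm k (z.dx.mul u) y,
    innerH_comm k (u.dx.mul z) y, innerH_comm k z, innerH_comm k z, CS.mul_comm z y.dx,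
    CS.mul_comm z.dx y]
  ring

/-! ## Derivatives on the diffeomorphism group -/

section

variable {F : Type} [AddCommGroup F] [Module ℝ F] [TopologicalSpace F]

theorem hasDerivAlong_iff {f : D → F} {φ : D} {v : CS} {L : F} :
    HasDerivAlong f φ v L ↔ HasDirDeriv (fun u => f (φ.translate u)) 0 v L := by
  simp only [HasDerivAlong, HasDirDeriv, zero_add, D.translate_zero]

/-- Changes of charts are translations, so a derivative at `u` in the chart around `φ` is one at `0`
in the chart around `φ.translate u`. -/
theorem HasDirDeriv.hasDerivAlong {f : D → F} {φ : D} {u v : CS} {L : F}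
    (hu : u ∈ φ.chartTarget) (h : HasDirDeriv (fun u => f (φ.translate u)) u v L) :
    HasDerivAlong f (φ.translate u) v L := by
  refine Tendsto.congr' ?_ h
  filter_upwards [(eventually_line_mem φ.isOpen_chartTarget hu v).filter_mono nhdsWithin_le_nhds]
    with t ht
  rw [D.translate_translate hu ht]

theorem HasDerivAlong.derivAlong_eq [T2Space F] {f : D → F} {X : D → CS} {φ : D} {L : F}
    (h : HasDerivAlong f φ (X φ) L) : derivAlong X f φ = L :=
  Tendsto.limUnder_eq h

theorem IsSmooth.exists_hasDerivAlong {f : D → F} (hf : IsSmooth f) (φ : D) (v : CS) :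
    ∃ L, HasDerivAlong f φ v L := by
  obtain ⟨-, f', h1, -⟩ := hf φ 1
  exact ⟨_, hasDerivAlong_iff.mpr (h1 0 φ.zero_mem_chartTarget v)⟩

theorem IsSmooth.hasDerivAlong [T2Space F] {f : D → F} (hf : IsSmooth f) (X : D → CS) (φ : D) :
    HasDerivAlong f φ (X φ) (derivAlong X f φ) := by
  obtain ⟨L, hL⟩ := hf.exists_hasDerivAlong φ (X φ)
  rwa [hL.derivAlong_eq]

theorem IsSmooth.derivAlong [T2Space F] [IsTopologicalAddGroup F] [ContinuousSMul ℝ F]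
    [LocallyConvexSpace ℝ F] {f : D → F} (hf : IsSmooth f) {X : D → CS} (hX : IsSmooth X) :
    IsSmooth (derivAlong X f) := by
  intro φ n
  obtain ⟨-, f', h1, h2⟩ := hf φ (n + 1)
  have h3 : CnOn n (fun u : CS => (u, X (φ.translate u))) φ.chartTarget :=
    (CnOn.clm n (ContinuousLinearMap.id ℝ CS) _).prodMk (hX φ n)
  refine (h2.comp (φ.isOpen_chartTarget.prod isOpen_univ) h3 fun u hu => ⟨hu, trivial⟩).congr
    φ.isOpen_chartTarget fun u hu => ?_
  exact (HasDerivAlong.derivAlong_eq ((h1 u hu _).hasDerivAlong hu)).symm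

theorem IsSmooth.hasDerivAlong_add [T2Space F] [IsTopologicalAddGroup F] [ContinuousSMul ℝ F]
    [LocallyConvexSpace ℝ F] {f : D → F} (hf : IsSmooth f) {φ : D} {v w : CS} {L M : F}
    (hv : HasDerivAlong f φ v L) (hw : HasDerivAlong f φ w M) :
    HasDerivAlong f φ (v + w) (L + M) := by
  rw [hasDerivAlong_iff] at *
  exact (hf φ 1).hasDirDeriv_add φ.isOpen_chartTarget φ.zero_mem_chartTarget hv hw

end

/-! ### Right translation in charts, and its derivatives. -/

theorem add_comp (u v : CS) (η : D) : (u + v).comp η = u.comp η + v.comp η := rfl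
theorem sub_comp (u v : CS) (η : D) : (u - v).comp η = u.comp η - v.comp η := rfl
theorem smul_comp (c : ℝ) (v : CS) (η : D) : (c • v).comp η = c • v.comp η := rfl
theorem mul_comp (u v : CS) (η : D) : (u.mul v).comp η = (u.comp η).mul (v.comp η) := rfl
theorem comp_id (u : CS) : u.comp D.id = u := rfl

theorem add_mem_diffDomain_of_mem_chartTarget {u v : CS} (hu : u ∈ CS.diffDomain)
    (hv : v ∈ (toD u).chartTarget) : u + v ∈ CS.diffDomain := by
  rw [toD_chartTarget hu] at hv
  exact hv.2

theorem cnOn_add_left (n : ℕ) (w : CS) (U : Set CS) : CnOn n (fun u => w + u) U :=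
  (CnOn.const n w U).add (CnOn.clm n (ContinuousLinearMap.id ℝ CS) U)

theorem cnOn_comp_translate {n : ℕ} {f : CS → CS} {φ : D} (hf : CnOn n f φ.chartTarget) :
    CnOn n (fun u => (f u).comp (φ.translate u)) φ.chartTarget := by
  obtain ⟨w, hw, rfl⟩ := φ.exists_eq_toD
  refine (CS.cnOn_shift hf (cnOn_add_left n w _)).congr (D.isOpen_chartTarget _) fun u hu => ?_
  have hwu := add_mem_diffDomain_of_mem_chartTarget hw hu
  rw [toD_translate hw hwu, comp_toD hwu]

theorem cnOn_comp_inv_translate {n : ℕ} {f : CS → CS} {φ : D} (hf : CnOn n f φ.chartTarget) :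
    CnOn n (fun u => (f u).comp (φ.translate u).inv) φ.chartTarget := by
  obtain ⟨w, hw, rfl⟩ := φ.exists_eq_toD
  have hJ : CnOn n (fun u => invCoord (w + u)) (toD w).chartTarget :=
    (cnOn_invCoord n).comp CS.isOpen_diffDomain (cnOn_add_left n w _) fun u hu =>
      add_mem_diffDomain_of_mem_chartTarget hw hu
  refine (CS.cnOn_shift hf hJ).congr (D.isOpen_chartTarget _) fun u hu => ?_
  have hwu := add_mem_diffDomain_of_mem_chartTarget hw hu
  rw [toD_translate hw hwu, comp_toD_inv hwu]

theorem eventually_mem_chartTarget (φ : D) (v : CS) :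
    ∀ᶠ t : ℝ in 𝓝 0, (0 : CS) + t • v ∈ φ.chartTarget :=
  eventually_line_mem φ.isOpen_chartTarget φ.zero_mem_chartTarget v

/-- The derivative of `ψ ↦ Y_ψ ∘ ψ⁻¹`. -/
theorem HasDerivAlong.comp_inv {Y : D → CS} {φ : D} {v L : CS} (hY : HasDerivAlong Y φ v L) :
    HasDerivAlong (fun ψ => (Y ψ).comp ψ.inv) φ v
      (L.comp φ.inv - ((Y φ).comp φ.inv).dx.mul (v.comp φ.inv)) := by
  obtain ⟨w, hw, rfl⟩ := φ.exists_eq_toD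
  rw [hasDerivAlong_iff] at *
  have hJ : HasDirDeriv (fun u => invCoord (w + u)) 0 v
      (-(v.shift (invCoord w)).mul (CS.one + (invCoord w).dx)) := by
    simpa only [HasDirDeriv, zero_add, add_zero] using hasDirDeriv_invCoord hw v
  have h := CS.hasDirDeriv_shift_comp hY hJ
  -- The factor `1 + (invCoord w).dx` coming from inversion is exactly the one that `dx_shift` gives
  -- for the derivative of `Y ∘ φ⁻¹`.
  have e : L.comp (toD w).inv - ((Y (toD w)).comp (toD w).inv).dx.mul (v.comp (toD w).inv) =
      L.shift (invCoord (w + 0)) + ((Y ((toD w).translate 0)).dx.shift (invCoord (w + 0))).mul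
        (-(v.shift (invCoord w)).mul (CS.one + (invCoord w).dx)) := by
    rw [D.translate_zero, add_zero, comp_toD_inv hw, comp_toD_inv hw, comp_toD_inv hw, CS.dx_shift]
    refine CS.ext fun x => ?_
    simp only [CS.add_apply, CS.sub_apply, CS.mul_apply, CS.neg_apply]
    ring
  rw [e]
  refine h.congr_of_eventuallyEq ?_ ?_
  · rw [D.translate_zero, add_zero, comp_toD_inv hw]
  · filter_upwards [eventually_mem_chartTarget (toD w) v] with t ht
    have hwt := add_mem_diffDomain_of_mem_chartTarget hw ht
    rw [toD_translate hw hwt, comp_toD_inv hwt]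

/-- The derivative of a right-invariant vector field. -/
theorem hasDerivAlong_rightInv (η φ : D) (V v : CS) :
    HasDerivAlong (rightInv η V) φ v (((V.comp η.inv).dx.comp φ).mul v) := by
  obtain ⟨w, hw, rfl⟩ := φ.exists_eq_toD
  rw [hasDerivAlong_iff]
  have h := CS.hasDirDeriv_shift_right (V.comp η.inv) w v
  have h' : HasDirDeriv (fun u => (V.comp η.inv).shift (w + u)) 0 v
      (((V.comp η.inv).dx.comp (toD w)).mul v) := by
    rw [comp_toD hw]
    simpa only [HasDirDeriv, zero_add, add_zero] using h
  refine h'.congr_of_eventuallyEq ?_ ?_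
  · rw [D.translate_zero, add_zero, rightInv, comp_toD hw]
  · filter_upwards [eventually_mem_chartTarget (toD w) v] with t ht
    have hwt := add_mem_diffDomain_of_mem_chartTarget hw ht
    rw [toD_translate hw hwt, rightInv, comp_toD hwt]

/-! ## The Riemannian connection -/

/-- The covariant derivative of the right-invariant `H^k` metric. -/
def covDeriv (k : ℕ) (X Y : SmoothFields) : SmoothFields :=
  ⟨fun φ => derivAlong X Y φ -
    (christoffel k ((X φ).comp φ.inv) ((Y φ).comp φ.inv)).comp φ, fun φ n =>
    (IsSmooth.derivAlong Y.2 X.2 φ n).sub (cnOn_comp_translate (cnOn_christoffel k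
      (cnOn_comp_inv_translate (X.2 φ n)) (cnOn_comp_inv_translate (Y.2 φ n))))⟩

theorem covDeriv_apply (k : ℕ) (X Y : SmoothFields) (φ : D) :
    covDeriv k X Y φ = derivAlong X Y φ -
      (christoffel k ((X φ).comp φ.inv) ((Y φ).comp φ.inv)).comp φ := rfl

theorem SmoothFields.hasDerivAlong (X Y : SmoothFields) (φ : D) :
    HasDerivAlong Y φ (X φ) (derivAlong X Y φ) :=
  IsSmooth.hasDerivAlong Y.2 X φ

theorem SmoothFields.ext {X Y : SmoothFields} (h : ∀ φ, X φ = Y φ) : X = Y :=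
  Subtype.ext (funext h)

theorem SmoothFields.add_apply (X Y : SmoothFields) (φ : D) : (X + Y) φ = X φ + Y φ := rfl

theorem SmoothFields.smul_apply (f : SmoothFunctions) (X : SmoothFields) (φ : D) :
    (f • X) φ = f φ • X φ := rfl

theorem isConnection_covDeriv (k : ℕ) : IsConnection (covDeriv k) where
  add_left X X' Y := SmoothFields.ext fun φ => by
    have h : derivAlong (X + X' : SmoothFields) Y φ = derivAlong X Y φ + derivAlong X' Y φ :=
      HasDerivAlong.derivAlong_eq (IsSmooth.hasDerivAlong_add Y.2
        (SmoothFields.hasDerivAlong X Y φ) (SmoothFields.hasDerivAlong X' Y φ))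
    rw [SmoothFields.add_apply, covDeriv_apply, covDeriv_apply, covDeriv_apply, h,
      SmoothFields.add_apply, add_comp, map_add, LinearMap.add_apply, add_comp]
    abel
  smul_left f X Y := SmoothFields.ext fun φ => by
    have h : derivAlong (f • X : SmoothFields) Y φ = f φ • derivAlong X Y φ :=
      HasDerivAlong.derivAlong_eq (hasDerivAlong_iff.mpr
        ((hasDerivAlong_iff.mp (SmoothFields.hasDerivAlong X Y φ)).smul_dir (f φ)))
    rw [SmoothFields.smul_apply, covDeriv_apply, covDeriv_apply, h, SmoothFields.smul_apply,
      smul_comp, map_smul, LinearMap.smul_apply, smul_comp, smul_sub]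
  add_right X Y Y' := SmoothFields.ext fun φ => by
    have h : derivAlong X (Y + Y' : SmoothFields) φ = derivAlong X Y φ + derivAlong X Y' φ :=
      HasDerivAlong.derivAlong_eq (hasDerivAlong_iff.mpr
        ((hasDerivAlong_iff.mp (SmoothFields.hasDerivAlong X Y φ)).add
          (hasDerivAlong_iff.mp (SmoothFields.hasDerivAlong X Y' φ))))
    rw [SmoothFields.add_apply, covDeriv_apply, covDeriv_apply, covDeriv_apply, h,
      SmoothFields.add_apply, add_comp, map_add, add_comp]
    abel
  leibniz f X Y φ := by
    have hb : Continuous fun p : ℝ × CS => LinearMap.lsmul ℝ CS p.1 p.2 := continuous_smul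
    have h : derivAlong X (f • Y : SmoothFields) φ =
        f φ • derivAlong X Y φ + derivAlong X f φ • Y φ := by
      refine HasDerivAlong.derivAlong_eq (hasDerivAlong_iff.mpr ?_)
      have h1 := (hasDerivAlong_iff.mp (IsSmooth.hasDerivAlong f.2 X φ)).bilin
        (LinearMap.lsmul ℝ CS) hb (hasDerivAlong_iff.mp (SmoothFields.hasDerivAlong X Y φ))
      rw [D.translate_zero, add_comm] at h1
      exact h1
    rw [covDeriv_apply, covDeriv_apply, h, SmoothFields.smul_apply, smul_comp, map_smul, smul_comp,
      smul_sub]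
    abel

theorem metric_eq (k : ℕ) (φ : D) (V W : CS) :
    metric k φ V W = innerHₗ k (V.comp φ.inv) (W.comp φ.inv) := (innerHₗ_apply k _ _).symm

theorem metric_comm (k : ℕ) (φ : D) (V W : CS) : metric k φ V W = metric k φ W V :=
  innerH_comm k _ _

theorem isRiemannianConnection_covDeriv (k : ℕ) : IsRiemannianConnection k (covDeriv k) where
  toIsConnection := isConnection_covDeriv k
  torsion_free X Y φ := by
    rw [covDeriv_apply, covDeriv_apply, christoffel_comm k ((Y φ).comp φ.inv), bracket]
    abel
  metric_compatible X Y Z φ := by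
    have hY := hasDerivAlong_iff.mp (SmoothFields.hasDerivAlong X Y φ).comp_inv
    have hZ := hasDerivAlong_iff.mp (SmoothFields.hasDerivAlong X Z φ).comp_inv
    have h := HasDirDeriv.bilin (innerHₗ k) (continuous_innerHₗ k) hY hZ
    have hΓ := innerH_christoffel k ((X φ).comp φ.inv) ((Y φ).comp φ.inv) ((Z φ).comp φ.inv)
    have hval : metric k φ (covDeriv k X Y φ) (Z φ) + metric k φ (Y φ) (covDeriv k X Z φ) =
        innerHₗ k ((derivAlong X Y φ).comp φ.inv -
            ((Y φ).comp φ.inv).dx.mul ((X φ).comp φ.inv)) ((Z φ).comp φ.inv) +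
          innerHₗ k ((Y φ).comp φ.inv) ((derivAlong X Z φ).comp φ.inv -
            ((Z φ).comp φ.inv).dx.mul ((X φ).comp φ.inv)) := by
      rw [metric_eq, metric_eq, covDeriv_apply, covDeriv_apply, sub_comp, sub_comp, comp_comp_inv,
        comp_comp_inv]
      simp only [← innerHₗ_apply, map_sub, LinearMap.sub_apply] at hΓ ⊢
      linarith
    rw [hasDerivAlong_iff, hval]
    simp only [D.translate_zero] at h
    exact h.congr_of_eventuallyEq (innerHₗ_apply k _ _)
      (Eventually.of_forall fun t => innerHₗ_apply k _ _)

/-- The difference of the connections is symmetric by torsion-freeness and skew in its last two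
slots by compatibility; going once round the three arguments shows that it equals its own negative.
-/
theorem IsRiemannianConnection.eq {k : ℕ} {nabla nabla' : SmoothFields → SmoothFields → SmoothFields}
    (h : IsRiemannianConnection k nabla) (h' : IsRiemannianConnection k nabla') :
    nabla' = nabla := by
  have symm : ∀ (X Y : SmoothFields) (φ : D),
      nabla' X Y φ - nabla X Y φ = nabla' Y X φ - nabla Y X φ := fun X Y φ => by
    have h1 := (h'.torsion_free X Y φ).trans (h.torsion_free X Y φ).symm
    rw [sub_eq_sub_iff_add_eq_add] at h1 ⊢
    rw [h1, add_comm]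
  have skew : ∀ (X Y Z : SmoothFields) (φ : D),
      metric k φ (nabla' X Y φ - nabla X Y φ) (Z φ) =
        -metric k φ (nabla' X Z φ - nabla X Z φ) (Y φ) := fun X Y Z φ => by
    have h1 := tendsto_nhds_unique (h'.metric_compatible X Y Z φ) (h.metric_compatible X Y Z φ)
    rw [metric_comm k φ (Y φ), metric_comm k φ (Y φ)] at h1
    simp only [metric_eq, sub_comp, map_sub, LinearMap.sub_apply] at h1 ⊢
    linarith
  funext X Y
  refine SmoothFields.ext fun φ => ?_
  -- The constant field extends the difference at `φ`, so the test field is smooth without knowing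
  -- that the difference is tensorial.
  let Z : SmoothFields := ⟨fun _ => nabla' X Y φ - nabla X Y φ, fun _ n => CnOn.const n _ _⟩
  have h0 : metric k φ (nabla' X Y φ - nabla X Y φ) (Z φ) = 0 := by
    have h1 := skew X Y Z φ
    have h2 := skew Z X Y φ
    have h3 := skew Y Z X φ
    rw [symm X Z] at h1
    rw [symm Z Y] at h2
    rw [symm Y X] at h3
    linarith
  have h1 := congr_arg (fun u => u.comp φ) (eq_zero_of_innerH_self h0)
  simp only [comp_inv_comp] at h1
  exact sub_eq_zero.mp h1

/-! ### The explicit formula. -/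

theorem bracket_rightInv (η : D) (V W : CS) :
    bracket (rightInv η V) (rightInv η W) η =
      ((W.comp η.inv).dx.mul (V.comp η.inv) - (V.comp η.inv).dx.mul (W.comp η.inv)).comp η := by
  rw [bracket, (hasDerivAlong_rightInv η η W _).derivAlong_eq,
    (hasDerivAlong_rightInv η η V _).derivAlong_eq]
  rfl

/-- With `x`, `y` the values at `η` translated to the identity, the first bracket contributes `-y_x
x` besides `D_X Y`, and half the second `(y_x x - x_x y) / 2`; together they make the term `-(x y)_x
/ 2` of `-Γ`. -/
theorem covDeriv_eq (k : ℕ) (X Y : SmoothFields) (η : D) :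
    covDeriv k X Y η =
      bracket X (fun φ => Y φ - rightInv η (Y η) φ) η +
      (1 / 2 : ℝ) • (bracket (rightInv η (X η)) (rightInv η (Y η)) η -
        fieldB k (rightInv η (X η)) (rightInv η (Y η)) η -
        fieldB k (rightInv η (Y η)) (rightInv η (X η)) η) := by
  have h1 : derivAlong X (fun φ => Y φ - rightInv η (Y η) φ) η = derivAlong X Y η -
      (((Y η).comp η.inv).dx.mul ((X η).comp η.inv)).comp η := by
    refine HasDerivAlong.derivAlong_eq (hasDerivAlong_iff.mpr ?_)
    have h := (hasDerivAlong_iff.mp (SmoothFields.hasDerivAlong X Y η)).sub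
      (hasDerivAlong_iff.mp (hasDerivAlong_rightInv η η (Y η) (X η)))
    rwa [mul_comp, comp_inv_comp]
  -- The direction `Y - Y^R` vanishes at `η`.
  have h2 : derivAlong (fun φ => Y φ - rightInv η (Y η) φ) X η = 0 := by
    refine HasDerivAlong.derivAlong_eq (hasDerivAlong_iff.mpr ?_)
    rw [rightInv, comp_inv_comp, sub_self]
    exact hasDirDeriv_zero _ _
  rw [bracket_rightInv, bracket, h1, h2, covDeriv_apply, christoffel_apply, CS.dx_mul]
  simp only [fieldB, rightInv, comp_id]
  simp only [← sub_comp, ← smul_comp, sub_zero]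
  rw [sub_add, ← sub_comp]
  congr 2
  refine CS.ext fun x => ?_
  simp only [CS.add_apply, CS.sub_apply, CS.smul_apply, CS.mul_apply]
  ring

end CircleDiff

end

theorem theorem1 (k : ℕ) :
    Function.Bijective (CircleDiff.A k) ∧
    ∃ nabla : CircleDiff.SmoothFields → CircleDiff.SmoothFields → CircleDiff.SmoothFields,
      CircleDiff.IsRiemannianConnection k nabla ∧
      (∀ nabla', CircleDiff.IsRiemannianConnection k nabla' → nabla' = nabla) ∧
      ∀ (X Y : CircleDiff.SmoothFields) (η : CircleDiff.D),
        nabla X Y η =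
          CircleDiff.bracket X (fun φ => Y φ - CircleDiff.rightInv η (Y η) φ) η +
          (1 / 2 : ℝ) •
            (CircleDiff.bracket (CircleDiff.rightInv η (X η)) (CircleDiff.rightInv η (Y η)) η -
              CircleDiff.fieldB k (CircleDiff.rightInv η (X η)) (CircleDiff.rightInv η (Y η)) η -
              CircleDiff.fieldB k (CircleDiff.rightInv η (Y η)) (CircleDiff.rightInv η (X η)) η) :=
  ⟨CircleDiff.A_bijective k, CircleDiff.covDeriv k, CircleDiff.isRiemannianConnection_covDeriv k,
    fun _ h => (CircleDiff.isRiemannianConnection_covDeriv k).eq h,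
    fun X Y η => CircleDiff.covDeriv_eq k X Y η⟩
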